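/- **Setting.** Let $D^{2,2,2}$ be the modular lattice with unity $I$ freely generated by three chains $x_i\subseteq y_i$ ($i=1,2,3$); sum and intersection are written $a+b$ and $ab$. Let $K$ be a field. A representation $\rho$ of $D^{2,2,2}$ in a finite-dimensional $K$-space $X$ is a lattice morphism from $D^{2,2,2}$ to the lattice of subspaces of $X$ with $\rho(I)=X$; it is indecomposable if $X\ne0$ and there is no decomposition $X=U\oplus V$ with $U,V\neq 0$ and $\rho(a)=\rho(a)U+\rho(a)V$ for all $a$. Linear equivalence is the lattice congruence $a\equiv b \bmod\theta$ iff $\rho(a)=\rho(b)$ for all indecomposable $\rho$. An inclusion $a\subseteq b \bmod \theta$ is an inclusion of the classes in the quotient lattice $D^{2,2,2}/\theta$, i.e. $a+b\equiv b\bmod\theta$. *Atomic elements* ($\{i,j,k\}=\{1,2,3\}$): $a_0^{ij}=A_0^{ij}=I$ and, for $n\ge1$, $a_n^{ij}=x_i+y_ja_{n-1}^{jk}$, $A_n^{ij}=y_i+x_jA_{n-1}^{ki}$. *Admissible elements.* A word $\alpha=i_n\dots i_1$ in the letters $1,2,3$ with distinct neighbours is an admissible sequence; words that differ by replacements $iji\to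 iki$ ($i,j,k$ distinct) are identified. With $q=k+3p$, $\gamma=(213)^{2p}(21)^{2k}$ ($k>0$, $p\ge0$) and $\beta=(213)^{2p}(21)^{2k+1}$ ($k,p\ge0$), put $$\begin{array}{lll} \alpha & f_\alpha & e_\alpha\\ \gamma & y_1y_2a^{13}_qA^{32}_{k-1} & y_2A^{32}_{k-1}a^{21}_qA^{13}_ka^{13}_q\\ 3\gamma & y_3(x_1+x_2)A^{23}_qa^{31}_{k-1} & y_3a^{31}_{k-1}A^{12}_{q+1}a^{12}_kA^{23}_q\\ 13\gamma & y_3y_1a^{32}_{q+1}A^{21}_{k-1} & y_1A^{21}_{k-1}a^{13}_{q+1}A^{32}_ka^{32}_{q+1}\\ (213)\gamma & y_2(x_3+x_1)A^{12}_{q+1}a^{23}_{k-1} & y_2a^{23}_{k-1}A^{31}_{q+2}a^{31}_kA^{12}_{q+1}\\ 3(213)\gamma & y_2y_3a^{21}_{q+2}A^{13}_{k-1} & y_3A^{13}_{k-1}a^{32}_{q+2}A^{21}_ka^{21}_{q+2}\\ 13(213)\gamma & y_1(x_2+x_3)A^{31}_{q+2}a^{12}_{k-1} & y_1a^{12}_{k-1}A^{23}_{q+3}a^{23}_kA^{31}_{q+2}\\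 1(21)^{2k}\ (k\ge0) & x_1A^{23}_ka^{23}_k & y_1A^{31}_ka^{12}_kA^{23}_ka^{23}_k\\ 1(21)^{2k+1}\ (k\ge0) & y_1(x_2+x_3)A^{31}_ka^{12}_k & y_1A^{31}_ka^{12}_kA^{23}_{k+1}a^{23}_{k+1}\\ \beta & y_2y_3a^{21}_qA^{13}_k & y_2A^{32}_ka^{21}_qA^{13}_ka^{13}_{q+1}\\ 3\beta & x_3A^{12}_{q+1}a^{12}_k & y_3a^{31}_kA^{12}_{q+1}a^{12}_kA^{23}_{q+1}\\ 13\beta & y_1y_2a^{13}_{q+1}A^{32}_k & y_1A^{21}_ka^{13}_{q+1}A^{32}_ka^{32}_{q+2}\\ (213)\beta & x_2A^{31}_{q+2}a^{31}_k & y_2a^{23}_kA^{31}_{q+2}a^{31}_kA^{12}_{q+2}\\ 3(213)\beta & y_3y_1a^{32}_{q+2}A^{21}_k & y_3A^{13}_ka^{32}_{q+2}A^{21}_ka^{21}_{q+3}\\ 13(213)\beta & x_1A^{23}_{q+3}a^{23}_k & y_1a^{12}_kA^{23}_{q+3}a^{23}_kA^{31}_{q+3} \end{array}$$ and take in addition all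 rows obtained from these by permuting the indices $1,2,3$; up to the identification these rows contain all admissible sequences. *Cumulative elements:* for $n\ge1$ and $t=1,2,3$, $x_t(n)=\sum f_{i_n\dots i_2t}$ and $y_t(n)=\sum e_{i_n\dots i_2t}$, summed over the admissible sequences of length $n$ that end in $t$. *Perfect elements* ($\{i,j,k\}=\{1,2,3\}$): $a_i(0)=y_j+y_k$, $b_i(0)=x_i+y_j+y_k$, $c_i(0)=y_1+y_2+y_3$, and for $n\ge1$: $a_i(n)=x_j(n)+x_k(n)+y_j(n+1)+y_k(n+1)$, $b_i(n)=a_i(n)+x_i(n+1)$, $c_i(n)=a_i(n)+y_i(n+1)$. They generate the lattice $H^+(n)$. Its lower cube is $$U_n=\{b_1b_2b_3,\ a_1b_2b_3,\ b_1a_2b_3,\ b_1b_2a_3,\ a_1a_2b_3,\ a_1b_2a_3,\ b_1a_2a_3,\ a_1a_2a_3\},\quad a_i=a_i(n),\ b_i=b_i(n),$$ and the upper cube of $H^+(n+1)$ is $$V_{n+1}=\{c_1,\ c_2,\ c_3,\ c_1c_2,\ c_2c_3,\ c_1c_3,\ c_1c_2c_3,\ c_1+c_2+c_3\},\quad c_i=c_i(n+1).$$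 **Proposition.** For every $n\ge0$ (and every field $K$), in the lattice $D^{2,2,2}/\theta$ each of $U_n$ and $V_{n+1}$ is an $8$-element Boolean algebra, and $U_n\cup V_{n+1}$ is a $16$-element Boolean algebra, with respect to the operations of $D^{2,2,2}/\theta$ (that is, the set of classes of its elements has the stated number of elements, is closed under sum and intersection, is distributive, and has a least element, a greatest element and complements). Moreover, the following $8$ inclusions hold modulo $\theta$: $$c_i(n+1)\subseteq a_i(n)b_j(n)b_k(n),\qquad c_i(n+1)c_j(n+1)\subseteq a_i(n)a_j(n)b_k(n)\qquad(\{i,j,k\}=\{1,2,3\}),$$ $$c_1(n+1)c_2(n+1)c_3(n+1)\subseteq a_1(n)a_2(n)a_3(n),\qquad c_1(n+1)+c_2(n+1)+c_3(n+1)\subseteq b_1(n)b_2(n)b_3(n).$$ -/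

import Mathlib

universe u

/-! ## The modular lattice `D^{2,2,2}` -/

/-- Lattice polynomials in the generators `x_i`, `y_i` (`i` in a three-element index set)
and the unity `I`. -/
inductive Poly222 : Type
  | unit : Poly222
  | x : Fin 3 → Poly222
  | y : Fin 3 → Poly222
  | add : Poly222 → Poly222 → Poly222
  | mul : Poly222 → Poly222 → Poly222

namespace Poly222

/-- The least preorder on lattice polynomials for which `add` is a supremum, `mul` is an infimum,
`unit` is a greatest element, `x_i ⊆ y_i`, and the modular law holds. -/
inductive Le : Poly222 → Poly222 → Prop
  | refl (a : Poly222) : Le a a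
  | trans {a b c : Poly222} : Le a b → Le b c → Le a c
  | le_unit (a : Poly222) : Le a unit
  | x_le_y (i : Fin 3) : Le (x i) (y i)
  | le_add_left (a b : Poly222) : Le a (add a b)
  | le_add_right (a b : Poly222) : Le b (add a b)
  | add_le {a b c : Poly222} : Le a c → Le b c → Le (add a b) c
  | mul_le_left (a b : Poly222) : Le (mul a b) a
  | mul_le_right (a b : Poly222) : Le (mul a b) b
  | le_mul {a b c : Poly222} : Le a b → Le a c → Le a (mul b c)
  | modular {a b : Poly222} (c : Poly222) : Le a b → Le (mul b (add a c)) (add a (mul b c))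

instance : Preorder Poly222 where
  le := Le
  le_refl := Le.refl
  le_trans _ _ _ := Le.trans

end Poly222

/-- The lattice `D^{2,2,2}`: the modular lattice with unity `I` (written `⊤`) freely generated by
three chains `x_i ⊆ y_i`. The sum is `⊔`, the intersection is `⊓`, the inclusion is `≤`. -/
def D222 : Type := Antisymmetrization Poly222 (· ≤ ·)

namespace D222

instance : PartialOrder D222 := inferInstanceAs (PartialOrder (Antisymmetrization Poly222 (· ≤ ·)))

/-- The element of `D^{2,2,2}` given by a lattice polynomial. -/
def ofPoly (a : Poly222) : D222 := toAntisymmetrization (· ≤ ·) a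

theorem ofPoly_le {a b : Poly222} : ofPoly a ≤ ofPoly b ↔ a ≤ b := Iff.rfl

theorem ofPoly_eq {a b : Poly222} (h : a ≤ b) (h' : b ≤ a) : ofPoly a = ofPoly b :=
  le_antisymm (ofPoly_le.2 h) (ofPoly_le.2 h')

theorem ofPoly_surj (a : D222) : ∃ p, ofPoly p = a := Quotient.exists_rep a

/-- The sum of two elements. -/
def add : D222 → D222 → D222 :=
  Quotient.map₂ Poly222.add fun _ _ h₁ _ _ h₂ =>
    ⟨.add_le (.trans h₁.1 (.le_add_left _ _)) (.trans h₂.1 (.le_add_right _ _)),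
      .add_le (.trans h₁.2 (.le_add_left _ _)) (.trans h₂.2 (.le_add_right _ _))⟩

/-- The intersection of two elements. -/
def mul : D222 → D222 → D222 :=
  Quotient.map₂ Poly222.mul fun _ _ h₁ _ _ h₂ =>
    ⟨.le_mul (.trans (.mul_le_left _ _) h₁.1) (.trans (.mul_le_right _ _) h₂.1),
      .le_mul (.trans (.mul_le_left _ _) h₁.2) (.trans (.mul_le_right _ _) h₂.2)⟩

instance : Lattice D222 where
  __ := (inferInstance : PartialOrder D222)
  sup := add
  inf := mul
  le_sup_left a b := by
    obtain ⟨a, rfl⟩ := ofPoly_surj a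
    obtain ⟨b, rfl⟩ := ofPoly_surj b
    exact Poly222.Le.le_add_left a b
  le_sup_right a b := by
    obtain ⟨a, rfl⟩ := ofPoly_surj a
    obtain ⟨b, rfl⟩ := ofPoly_surj b
    exact Poly222.Le.le_add_right a b
  sup_le a b c h h' := by
    obtain ⟨a, rfl⟩ := ofPoly_surj a
    obtain ⟨b, rfl⟩ := ofPoly_surj b
    obtain ⟨c, rfl⟩ := ofPoly_surj c
    exact Poly222.Le.add_le (ofPoly_le.1 h) (ofPoly_le.1 h')
  inf_le_left a b := by
    obtain ⟨a, rfl⟩ := ofPoly_surj a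
    obtain ⟨b, rfl⟩ := ofPoly_surj b
    exact Poly222.Le.mul_le_left a b
  inf_le_right a b := by
    obtain ⟨a, rfl⟩ := ofPoly_surj a
    obtain ⟨b, rfl⟩ := ofPoly_surj b
    exact Poly222.Le.mul_le_right a b
  le_inf a b c h h' := by
    obtain ⟨a, rfl⟩ := ofPoly_surj a
    obtain ⟨b, rfl⟩ := ofPoly_surj b
    obtain ⟨c, rfl⟩ := ofPoly_surj c
    exact Poly222.Le.le_mul (ofPoly_le.1 h) (ofPoly_le.1 h')

instance : OrderTop D222 where
  top := ofPoly .unit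
  le_top a := by
    obtain ⟨a, rfl⟩ := ofPoly_surj a
    exact Poly222.Le.le_unit a

/-- The generator `x_i`. -/
def x (i : Fin 3) : D222 := ofPoly (.x i)

/-- The generator `y_i`. -/
def y (i : Fin 3) : D222 := ofPoly (.y i)

theorem x_le_y (i : Fin 3) : x i ≤ y i := Poly222.Le.x_le_y i

instance : IsModularLattice D222 where
  sup_inf_le_assoc_of_le := by
    intro a b c h
    obtain ⟨a, rfl⟩ := ofPoly_surj a
    obtain ⟨b, rfl⟩ := ofPoly_surj b
    obtain ⟨c, rfl⟩ := ofPoly_surj c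
    rw [inf_comm, inf_comm (ofPoly b)]
    exact Poly222.Le.modular b (ofPoly_le.1 h)

/-! ## Atomic, admissible and cumulative elements -/

/-- The atomic element `a_n^{ij}`, where `k` is the third index:
`a_0^{ij} = I` and `a_n^{ij} = x_i + y_j a_{n-1}^{jk}`. -/
def aAtom : ℕ → Fin 3 → Fin 3 → Fin 3 → D222
  | 0, _, _, _ => ⊤
  | n + 1, i, j, k => x i ⊔ y j ⊓ aAtom n j k i

/-- The atomic element `A_n^{ij}`, where `k` is the third index:
`A_0^{ij} = I` and `A_n^{ij} = y_i + x_j A_{n-1}^{ki}`. -/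
def AAtom : ℕ → Fin 3 → Fin 3 → Fin 3 → D222
  | 0, _, _, _ => ⊤
  | n + 1, i, j, k => y i ⊔ x j ⊓ AAtom n k i j

/-- A row of the table of admissible elements: an admissible sequence `α`, written from left to
right, with the admissible elements `f_α` and `e_α`. -/
structure AdmRow where
  word : List (Fin 3)
  f : D222
  e : D222

/-- The word `w` repeated `m` times. -/
def wordPow (w : List (Fin 3)) (m : ℕ) : List (Fin 3) := (List.replicate m w).flatten

/-- The table of admissible sequences and admissible elements. The letters `1`, `2`, `3` of the
sequences `γ = (213)^{2p}(21)^{2k}`, `β = (213)^{2p}(21)^{2k+1}` and the indices `1`, `2`, `3` of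
the elements are replaced by `i₁`, `i₂`, `i₃`; throughout, `q = k + 3p`. The rows are numbered
`1, …, 14`; the rows `1, …, 6` are for `k > 0`, and the rows `7`, `8` do not depend on `p`. -/
def admRow (i₁ i₂ i₃ : Fin 3) (p k : ℕ) (line : ℕ) : AdmRow :=
  let q := k + 3 * p
  let γ := wordPow [i₂, i₁, i₃] (2 * p) ++ wordPow [i₂, i₁] (2 * k)
  let β := wordPow [i₂, i₁, i₃] (2 * p) ++ wordPow [i₂, i₁] (2 * k + 1)
  let x₁ := x i₁
  let x₂ := x i₂
  let x₃ := x i₃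
  let y₁ := y i₁
  let y₂ := y i₂
  let y₃ := y i₃
  let a12 := fun n => aAtom n i₁ i₂ i₃
  let a13 := fun n => aAtom n i₁ i₃ i₂
  let a21 := fun n => aAtom n i₂ i₁ i₃
  let a23 := fun n => aAtom n i₂ i₃ i₁
  let a31 := fun n => aAtom n i₃ i₁ i₂
  let a32 := fun n => aAtom n i₃ i₂ i₁
  let A12 := fun n => AAtom n i₁ i₂ i₃
  let A13 := fun n => AAtom n i₁ i₃ i₂
  let A21 := fun n => AAtom n i₂ i₁ i₃
  let A23 := fun n => AAtom n i₂ i₃ i₁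
  let A31 := fun n => AAtom n i₃ i₁ i₂
  let A32 := fun n => AAtom n i₃ i₂ i₁
  match line with
  | 1 => ⟨γ,
      y₁ ⊓ y₂ ⊓ a13 q ⊓ A32 (k - 1),
      y₂ ⊓ A32 (k - 1) ⊓ a21 q ⊓ A13 k ⊓ a13 q⟩
  | 2 => ⟨[i₃] ++ γ,
      y₃ ⊓ (x₁ ⊔ x₂) ⊓ A23 q ⊓ a31 (k - 1),
      y₃ ⊓ a31 (k - 1) ⊓ A12 (q + 1) ⊓ a12 k ⊓ A23 q⟩
  | 3 => ⟨[i₁, i₃] ++ γ,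
      y₃ ⊓ y₁ ⊓ a32 (q + 1) ⊓ A21 (k - 1),
      y₁ ⊓ A21 (k - 1) ⊓ a13 (q + 1) ⊓ A32 k ⊓ a32 (q + 1)⟩
  | 4 => ⟨[i₂, i₁, i₃] ++ γ,
      y₂ ⊓ (x₃ ⊔ x₁) ⊓ A12 (q + 1) ⊓ a23 (k - 1),
      y₂ ⊓ a23 (k - 1) ⊓ A31 (q + 2) ⊓ a31 k ⊓ A12 (q + 1)⟩
  | 5 => ⟨[i₃, i₂, i₁, i₃] ++ γ,
      y₂ ⊓ y₃ ⊓ a21 (q + 2) ⊓ A13 (k - 1),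
      y₃ ⊓ A13 (k - 1) ⊓ a32 (q + 2) ⊓ A21 k ⊓ a21 (q + 2)⟩
  | 6 => ⟨[i₁, i₃, i₂, i₁, i₃] ++ γ,
      y₁ ⊓ (x₂ ⊔ x₃) ⊓ A31 (q + 2) ⊓ a12 (k - 1),
      y₁ ⊓ a12 (k - 1) ⊓ A23 (q + 3) ⊓ a23 k ⊓ A31 (q + 2)⟩
  | 7 => ⟨[i₁] ++ wordPow [i₂, i₁] (2 * k),
      x₁ ⊓ A23 k ⊓ a23 k,
      y₁ ⊓ A31 k ⊓ a12 k ⊓ A23 k ⊓ a23 k⟩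
  | 8 => ⟨[i₁] ++ wordPow [i₂, i₁] (2 * k + 1),
      y₁ ⊓ (x₂ ⊔ x₃) ⊓ A31 k ⊓ a12 k,
      y₁ ⊓ A31 k ⊓ a12 k ⊓ A23 (k + 1) ⊓ a23 (k + 1)⟩
  | 9 => ⟨β,
      y₂ ⊓ y₃ ⊓ a21 q ⊓ A13 k,
      y₂ ⊓ A32 k ⊓ a21 q ⊓ A13 k ⊓ a13 (q + 1)⟩
  | 10 => ⟨[i₃] ++ β,
      x₃ ⊓ A12 (q + 1) ⊓ a12 k,
      y₃ ⊓ a31 k ⊓ A12 (q + 1) ⊓ a12 k ⊓ A23 (q + 1)⟩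
  | 11 => ⟨[i₁, i₃] ++ β,
      y₁ ⊓ y₂ ⊓ a13 (q + 1) ⊓ A32 k,
      y₁ ⊓ A21 k ⊓ a13 (q + 1) ⊓ A32 k ⊓ a32 (q + 2)⟩
  | 12 => ⟨[i₂, i₁, i₃] ++ β,
      x₂ ⊓ A31 (q + 2) ⊓ a31 k,
      y₂ ⊓ a23 k ⊓ A31 (q + 2) ⊓ a31 k ⊓ A12 (q + 2)⟩
  | 13 => ⟨[i₃, i₂, i₁, i₃] ++ β,
      y₃ ⊓ y₁ ⊓ a32 (q + 2) ⊓ A21 k,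
      y₃ ⊓ A13 k ⊓ a32 (q + 2) ⊓ A21 k ⊓ a21 (q + 3)⟩
  | _ => ⟨[i₁, i₃, i₂, i₁, i₃] ++ β,
      x₁ ⊓ A23 (q + 3) ⊓ a23 k,
      y₁ ⊓ a12 k ⊓ A23 (q + 3) ⊓ a23 k ⊓ A31 (q + 3)⟩

/-- The parameters of a row of the table: a permutation of the three indices (which yields the
sequences that start from any index, and the exchange of the two other indices), the exponent
parameters `p` and `k`, and the number of the row. -/
abbrev AdmIndex : Type := Equiv.Perm (Fin 3) × ℕ × ℕ × ℕ

/-- The row with the given parameters. -/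
def rowOf (s : AdmIndex) : AdmRow :=
  admRow (s.1 0) (s.1 1) (s.1 2) s.2.1 s.2.2.1 s.2.2.2

/-- The rows whose admissible sequence `i_n … i_2 t` has length `n` and ends in `t`. (In each of
the rows with a sequence of length `n` one may take `p, k ≤ n`, so that the bounds on `p` and `k`
are no restriction.) -/
def admIndices (t : Fin 3) (n : ℕ) : Finset AdmIndex :=
  (Finset.univ ×ˢ Finset.range (n + 1) ×ˢ Finset.range (n + 1) ×ˢ Finset.Icc 1 14).filter
    fun s => (s.2.2.2 ≤ 6 → 0 < s.2.2.1) ∧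
      (rowOf s).word.length = n ∧ (rowOf s).word.getLast? = some t

theorem wordPow_length (w : List (Fin 3)) (m : ℕ) : (wordPow w m).length = m * w.length := by
  simp [wordPow]

theorem wordPow_succ (w : List (Fin 3)) (m : ℕ) : wordPow w (m + 1) = wordPow w m ++ w := by
  simp [wordPow, List.replicate_succ']

theorem mem_admIndices {t : Fin 3} {n : ℕ} {σ : Equiv.Perm (Fin 3)} {p k line : ℕ} :
    (σ, p, k, line) ∈ admIndices t n ↔ (p < n + 1 ∧ k < n + 1 ∧ 1 ≤ line ∧ line ≤ 14) ∧
      (line ≤ 6 → 0 < k) ∧ (admRow (σ 0) (σ 1) (σ 2) p k line).word.length = n ∧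
        (admRow (σ 0) (σ 1) (σ 2) p k line).word.getLast? = some t := by
  unfold admIndices
  rw [Finset.mem_filter]
  simp only [rowOf, Finset.mem_product, Finset.mem_univ, Finset.mem_range, Finset.mem_Icc,
    true_and]

/-- There is an admissible sequence of each positive length ending in `t`. -/
theorem admIndices_nonempty (t : Fin 3) {n : ℕ} (hn : 0 < n) : (admIndices t n).Nonempty := by
  obtain ⟨m, hm | hm | hm | hm⟩ : ∃ m, n = 4 * m + 1 ∨ n = 4 * m + 3 ∨ n = 4 * m + 2 ∨
      n = 4 * (m + 1) := ⟨(n - 1) / 4, by omega⟩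
  · refine ⟨(Equiv.swap 0 t, 0, m, 7), mem_admIndices.2 ?_⟩
    refine ⟨by omega, by omega, by simp [admRow, wordPow_length]; omega, ?_⟩
    simp only [admRow]
    rcases m with _ | m
    · simp [wordPow]
    · rw [show 2 * (m + 1) = 2 * m + 1 + 1 by ring, wordPow_succ, ← List.append_assoc,
        List.getLast?_append]
      simp
  · refine ⟨(Equiv.swap 0 t, 0, m, 8), mem_admIndices.2 ?_⟩
    refine ⟨by omega, by omega, by simp [admRow, wordPow_length]; omega, ?_⟩
    simp only [admRow]
    rw [wordPow_succ, ← List.append_assoc, List.getLast?_append]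
    simp
  · refine ⟨(Equiv.swap 0 t, 0, m, 9), mem_admIndices.2 ?_⟩
    refine ⟨by omega, by omega, by simp [admRow, wordPow_length]; omega, ?_⟩
    simp only [admRow]
    rw [wordPow_succ]
    simp
  · refine ⟨(Equiv.swap 0 t, 0, m + 1, 1), mem_admIndices.2 ?_⟩
    refine ⟨by omega, by omega, by simp [admRow, wordPow_length]; omega, ?_⟩
    simp only [admRow]
    rw [show 2 * (m + 1) = 2 * m + 1 + 1 by ring, wordPow_succ]
    simp

/-- The cumulative element `x_t(n) = ∑ f_{i_n … i_2 t}`, `n ≥ 1` (the value at `n = 0` is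
irrelevant). -/
def xCum (t : Fin 3) (n : ℕ) : D222 :=
  if hn : 0 < n then (admIndices t n).sup' (admIndices_nonempty t hn) fun s => (rowOf s).f else ⊤

/-- The cumulative element `y_t(n) = ∑ e_{i_n … i_2 t}`, `n ≥ 1` (the value at `n = 0` is
irrelevant). -/
def yCum (t : Fin 3) (n : ℕ) : D222 :=
  if hn : 0 < n then (admIndices t n).sup' (admIndices_nonempty t hn) fun s => (rowOf s).e else ⊤

/-! ## The generators `a_i(n) ⊆ b_i(n) ⊆ c_i(n)` of `H^+(n)` and the two cubes

For an index `i`, the two other indices are `i + 1` and `i + 2` (modulo three). -/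

/-- `a_i(0) = y_j + y_k`, and `a_i(n) = x_j(n) + x_k(n) + y_j(n+1) + y_k(n+1)` for `n ≥ 1`. -/
def aGen (i : Fin 3) : ℕ → D222
  | 0 => y (i + 1) ⊔ y (i + 2)
  | n + 1 => xCum (i + 1) (n + 1) ⊔ xCum (i + 2) (n + 1) ⊔
      yCum (i + 1) (n + 2) ⊔ yCum (i + 2) (n + 2)

/-- `b_i(0) = x_i + y_j + y_k`, and `b_i(n) = a_i(n) + x_i(n+1)` for `n ≥ 1`. -/
def bGen (i : Fin 3) : ℕ → D222
  | 0 => x i ⊔ y (i + 1) ⊔ y (i + 2)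
  | n + 1 => aGen i (n + 1) ⊔ xCum i (n + 2)

/-- `c_i(0) = y_1 + y_2 + y_3`, and `c_i(n) = a_i(n) + y_i(n+1)` for `n ≥ 1`. -/
def cGen (i : Fin 3) : ℕ → D222
  | 0 => y 0 ⊔ y 1 ⊔ y 2
  | n + 1 => aGen i (n + 1) ⊔ yCum i (n + 2)

/-- The lower cube `U_n` of `H^+(n)`. -/
def lowerCube (n : ℕ) : Set D222 :=
  let a := fun i => aGen i n
  let b := fun i => bGen i n
  {b 0 ⊓ b 1 ⊓ b 2, a 0 ⊓ b 1 ⊓ b 2, b 0 ⊓ a 1 ⊓ b 2, b 0 ⊓ b 1 ⊓ a 2,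
    a 0 ⊓ a 1 ⊓ b 2, a 0 ⊓ b 1 ⊓ a 2, b 0 ⊓ a 1 ⊓ a 2, a 0 ⊓ a 1 ⊓ a 2}

/-- The upper cube `V_n` of `H^+(n)` (`n ≥ 1`). -/
def upperCube (n : ℕ) : Set D222 :=
  let c := fun i => cGen i n
  {c 0, c 1, c 2, c 0 ⊓ c 1, c 1 ⊓ c 2, c 0 ⊓ c 2, c 0 ⊓ c 1 ⊓ c 2, c 0 ⊔ c 1 ⊔ c 2}

/-! ## Linear representations and linear equivalence -/

/-- A linear representation of `D^{2,2,2}` in the vector space `X`: a morphism of lattices with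
unity into the lattice of subspaces of `X`. -/
structure LinRep (K : Type u) [Field K] (X : Type u) [AddCommGroup X] [Module K X] extends
    LatticeHom D222 (Submodule K X) where
  map_top' : toFun ⊤ = ⊤

/-- A representation in `X` is indecomposable if `X ≠ 0` and there is no direct decomposition
`X = U ⊕ V` with `U, V ≠ 0` and `ρ(a) = ρ(a)U + ρ(a)V` for all `a`. -/
def LinRep.Indecomposable {K : Type u} [Field K] {X : Type u} [AddCommGroup X] [Module K X]
    (ρ : LinRep K X) : Prop :=
  Nontrivial X ∧ ∀ U V : Submodule K X, IsCompl U V →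
    (∀ a : D222, ρ.toLatticeHom a = ρ.toLatticeHom a ⊓ U ⊔ ρ.toLatticeHom a ⊓ V) →
    U = ⊥ ∨ V = ⊥

/-- The linear equivalence `θ`: `a ≡ b mod θ` if `ρ(a) = ρ(b)` for all indecomposable
representations `ρ` in finite-dimensional vector spaces over `K`. -/
def theta (K : Type u) [Field K] : LatticeCon D222 where
  r a b := ∀ (X : Type u) [AddCommGroup X] [Module K X] [FiniteDimensional K X] (ρ : LinRep K X),
    ρ.Indecomposable → ρ.toLatticeHom a = ρ.toLatticeHom b
  iseqv :=
    { refl := fun _ _ _ _ _ _ _ => rfl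
      symm := fun h X _ _ _ ρ hρ => (h X ρ hρ).symm
      trans := fun h h' X _ _ _ ρ hρ => (h X ρ hρ).trans (h' X ρ hρ) }
  inf h h' X _ _ _ ρ hρ := by rw [map_inf, map_inf, h X ρ hρ, h' X ρ hρ]
  sup h h' X _ _ _ ρ hρ := by rw [map_sup, map_sup, h X ρ hρ, h' X ρ hρ]

end D222

/-- The quotient lattice `D^{2,2,2}/θ`. -/
def D222ModTheta (K : Type u) [Field K] : Type := Quotient (D222.theta K).toSetoid

namespace D222ModTheta

/-- The class of an element of `D^{2,2,2}` modulo `θ`. -/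
def mk (K : Type u) [Field K] (a : D222) : D222ModTheta K :=
  Quotient.mk (D222.theta K).toSetoid a

theorem mk_surj {K : Type u} [Field K] (a : D222ModTheta K) : ∃ b, mk K b = a :=
  Quotient.exists_rep a

instance (K : Type u) [Field K] : Max (D222ModTheta K) :=
  ⟨Quotient.map₂ (· ⊔ ·) fun _ _ h _ _ h' => (D222.theta K).sup h h'⟩

instance (K : Type u) [Field K] : Min (D222ModTheta K) :=
  ⟨Quotient.map₂ (· ⊓ ·) fun _ _ h _ _ h' => (D222.theta K).inf h h'⟩

theorem mk_sup {K : Type u} [Field K] (a b : D222) : mk K a ⊔ mk K b = mk K (a ⊔ b) := rfl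

theorem mk_inf {K : Type u} [Field K] (a b : D222) : mk K a ⊓ mk K b = mk K (a ⊓ b) := rfl

/-- The lattice operations are those induced from `D^{2,2,2}`; the inclusion is
`a ≤ b ↔ a ⊔ b = b`. -/
instance (K : Type u) [Field K] : Lattice (D222ModTheta K) :=
  Lattice.mk'
    (fun a b => by
      obtain ⟨a, rfl⟩ := mk_surj a
      obtain ⟨b, rfl⟩ := mk_surj b
      rw [mk_sup, mk_sup, sup_comm])
    (fun a b c => by
      obtain ⟨a, rfl⟩ := mk_surj a
      obtain ⟨b, rfl⟩ := mk_surj b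
      obtain ⟨c, rfl⟩ := mk_surj c
      rw [mk_sup, mk_sup, mk_sup, mk_sup, sup_assoc])
    (fun a b => by
      obtain ⟨a, rfl⟩ := mk_surj a
      obtain ⟨b, rfl⟩ := mk_surj b
      rw [mk_inf, mk_inf, inf_comm])
    (fun a b c => by
      obtain ⟨a, rfl⟩ := mk_surj a
      obtain ⟨b, rfl⟩ := mk_surj b
      obtain ⟨c, rfl⟩ := mk_surj c
      rw [mk_inf, mk_inf, mk_inf, mk_inf, inf_assoc])
    (fun a b => by
      obtain ⟨a, rfl⟩ := mk_surj a
      obtain ⟨b, rfl⟩ := mk_surj b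
      rw [mk_inf, mk_sup, sup_inf_self])
    (fun a b => by
      obtain ⟨a, rfl⟩ := mk_surj a
      obtain ⟨b, rfl⟩ := mk_surj b
      rw [mk_sup, mk_inf, inf_sup_self])

end D222ModTheta

/-- A subset `S` of a lattice is a Boolean algebra (with respect to the operations of the lattice):
it is closed under `⊔` and `⊓`, it is distributive, it has a least element `o` and a greatest
element `e`, and each of its elements has a complement in it. -/
structure IsBooleanSublattice {L : Type*} [Lattice L] (S : Set L) : Prop where
  supClosed : SupClosed S
  infClosed : InfClosed S
  distrib : ∀ a ∈ S, ∀ b ∈ S, ∀ c ∈ S, a ⊓ (b ⊔ c) = a ⊓ b ⊔ a ⊓ c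
  complemented : ∃ o ∈ S, ∃ e ∈ S, (∀ z ∈ S, o ≤ z ∧ z ≤ e) ∧
    ∀ z ∈ S, ∃ z' ∈ S, z ⊓ z' = o ∧ z ⊔ z' = e

/-!
The Coxeter functor `Φ⁺` of Gelfand and Ponomarev controls the perfect elements. If any two of the
subspaces `ρ(y_i)` span `X`, then `Φ⁺` preserves the endomorphism ring of `ρ`, hence its
indecomposability, and the subspace that a generator of `H⁺(n+1)` has in `ρ` is the sum of the three
images in `X` of the subspace that the same generator of `H⁺(n)` has in `Φ⁺ρ`; so it is `0` or `X`
as soon as the latter is `0` or everything. An indecomposable `ρ` for which this spanning condition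
fails is one-dimensional with at most one `ρ(y_i) ≠ 0`, and there the generators are computed
directly. By induction on `n`, every indecomposable representation sends the elements of the two
cubes to `0` or `X`, in one of six patterns.

Index the elements of the cubes by `{0,1}³ × {0,1}`, the last coordinate distinguishing `U_n` from
`V_{n+1}`. Two of the patterns are constant, and the other four are the coordinate functions, so
addition and intersection of classes are computed coordinatewise. All four coordinate functions
occur: for `n = 0` this is shown by examples, and the inverse Coxeter functor `Φ⁻` raises `n`. It
can be applied arbitrarily often to a representation `ρ` whose defect
`∑ (dim ρ(x_i) + dim ρ(y_i)) - 3 dim X` is negative, since `Φ⁻` preserves the defect.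
-/

/-! ## Representations -/

namespace Poly222

variable {L : Type*} [Lattice L] [OrderTop L]

/-- The value of a lattice polynomial at two families of elements `P`, `Q` of a lattice; the unity
is evaluated to `⊤`. -/
def eval (P Q : Fin 3 → L) : Poly222 → L
  | .unit => ⊤
  | .x i => P i
  | .y i => Q i
  | .add a b => eval P Q a ⊔ eval P Q b
  | .mul a b => eval P Q a ⊓ eval P Q b

theorem eval_mono [IsModularLattice L] {P Q : Fin 3 → L} (h : ∀ i, P i ≤ Q i) {a b : Poly222}
    (hab : a ≤ b) : eval P Q a ≤ eval P Q b := by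
  induction hab with
  | refl a => exact le_rfl
  | trans _ _ h₁ h₂ => exact h₁.trans h₂
  | le_unit a => exact le_top
  | x_le_y i => exact h i
  | le_add_left a b => exact le_sup_left
  | le_add_right a b => exact le_sup_right
  | add_le _ _ h₁ h₂ => exact sup_le h₁ h₂
  | mul_le_left a b => exact inf_le_left
  | mul_le_right a b => exact inf_le_right
  | le_mul _ _ h₁ h₂ => exact le_inf h₁ h₂
  | modular c _ h₁ =>
    simp only [eval]
    rw [inf_comm, inf_comm (eval P Q _) (eval P Q c)]
    exact IsModularLattice.sup_inf_le_assoc_of_le _ h₁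

end Poly222

namespace D222

@[elab_as_elim]
theorem induction {p : D222 → Prop} (top : p ⊤) (gen_x : ∀ i, p (x i)) (gen_y : ∀ i, p (y i))
    (sup : ∀ a b, p a → p b → p (a ⊔ b)) (inf : ∀ a b, p a → p b → p (a ⊓ b)) (a : D222) :
    p a := by
  obtain ⟨a, rfl⟩ := ofPoly_surj a
  induction a with
  | unit => exact top
  | x i => exact gen_x i
  | y i => exact gen_y i
  | add a b ha hb => exact sup _ _ ha hb
  | mul a b ha hb => exact inf _ _ ha hb

/-- The universal property of `D^{2,2,2}`: three chains `P i ≤ Q i` in a modular lattice with unity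
define a morphism from `D^{2,2,2}`. -/
def lift {L : Type*} [Lattice L] [OrderTop L] [IsModularLattice L] (P Q : Fin 3 → L)
    (h : ∀ i, P i ≤ Q i) : LatticeHom D222 L where
  toFun := Quotient.lift (Poly222.eval P Q) fun _ _ hab =>
    le_antisymm (Poly222.eval_mono h hab.1) (Poly222.eval_mono h hab.2)
  map_sup' a b := by
    obtain ⟨a, rfl⟩ := ofPoly_surj a
    obtain ⟨b, rfl⟩ := ofPoly_surj b
    rfl
  map_inf' a b := by
    obtain ⟨a, rfl⟩ := ofPoly_surj a
    obtain ⟨b, rfl⟩ := ofPoly_surj b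
    rfl

namespace LinRep

variable {K : Type u} [Field K] {X X' : Type u} [AddCommGroup X] [Module K X] [AddCommGroup X']
  [Module K X']

instance : CoeFun (LinRep K X) fun _ => D222 → Submodule K X := ⟨fun ρ => ρ.toLatticeHom⟩

@[simp] theorem apply_top (ρ : LinRep K X) : ρ ⊤ = ⊤ := ρ.map_top'

theorem mono (ρ : LinRep K X) {a b : D222} (h : a ≤ b) : ρ a ≤ ρ b :=
  OrderHomClass.mono ρ.toLatticeHom h

theorem x_le_y (ρ : LinRep K X) (i : Fin 3) : ρ (x i) ≤ ρ (y i) := ρ.mono (D222.x_le_y i)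

/-- The representation given by three chains of subspaces. -/
def ofChains (P Q : Fin 3 → Submodule K X) (h : ∀ i, P i ≤ Q i) : LinRep K X where
  __ := lift P Q h
  map_top' := rfl

@[simp] theorem ofChains_x (P Q : Fin 3 → Submodule K X) (h : ∀ i, P i ≤ Q i) (i : Fin 3) :
    ofChains P Q h (x i) = P i := rfl

@[simp] theorem ofChains_y (P Q : Fin 3 → Submodule K X) (h : ∀ i, P i ≤ Q i) (i : Fin 3) :
    ofChains P Q h (y i) = Q i := rfl

/-- An isomorphism of representations: a linear isomorphism that matches the subspaces of the
generators, hence (`Iso.map_apply`) those of all elements of `D^{2,2,2}`. -/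
structure Iso (ρ : LinRep K X) (ρ' : LinRep K X') extends X ≃ₗ[K] X' where
  map_x : ∀ i, (ρ (x i)).map (toLinearEquiv : X →ₗ[K] X') = ρ' (x i)
  map_y : ∀ i, (ρ (y i)).map (toLinearEquiv : X →ₗ[K] X') = ρ' (y i)

theorem Iso.map_apply {ρ : LinRep K X} {ρ' : LinRep K X'} (e : Iso ρ ρ') (a : D222) :
    (ρ a).map (e.toLinearEquiv : X →ₗ[K] X') = ρ' a := by
  induction a using D222.induction with
  | top => rw [apply_top, apply_top, Submodule.map_top, LinearEquiv.range]
  | gen_x i => exact e.map_x i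
  | gen_y i => exact e.map_y i
  | sup a b ha hb => rw [map_sup, map_sup, Submodule.map_sup, ha, hb]
  | inf a b ha hb => rw [map_inf, map_inf, Submodule.map_inf _ e.injective, ha, hb]

/-! ## Endomorphisms and indecomposability -/

open Module.End

/-- The endomorphism ring of a representation: the linear maps that preserve all its subspaces. -/
def endRing (ρ : LinRep K X) : Subring (Module.End K X) where
  carrier := {f | ∀ a, ρ a ∈ f.invtSubmodule}
  mul_mem' {f g} hf hg a := invtSubmodule.comp (f := f) (g := g) (hf a) (hg a)
  one_mem' a := by rw [invtSubmodule.one]; trivial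
  add_mem' {f g} hf hg a :=
    invtSubmodule_inf_invtSubmodule_le_invtSubmodule_add f g ⟨hf a, hg a⟩
  zero_mem' a := by rw [invtSubmodule.zero]; trivial
  neg_mem' {f} hf a v hv := (ρ a).neg_mem (hf a hv)

theorem mem_endRing {ρ : LinRep K X} {f : Module.End K X} :
    f ∈ ρ.endRing ↔ ∀ i, ρ (x i) ∈ f.invtSubmodule ∧ ρ (y i) ∈ f.invtSubmodule := by
  refine ⟨fun hf i => ⟨hf _, hf _⟩, fun hf a => ?_⟩
  induction a using D222.induction with
  | top => rw [apply_top]; exact invtSubmodule.top_mem f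
  | gen_x i => exact (hf i).1
  | gen_y i => exact (hf i).2
  | sup a b ha hb => rw [map_sup]; exact f.invtSubmodule.sup_mem ha hb
  | inf a b ha hb => rw [map_inf]; exact f.invtSubmodule.inf_mem ha hb

theorem Indecomposable.eq_zero_or_one {ρ : LinRep K X} (hρ : ρ.Indecomposable)
    {e : Module.End K X} (he : e ∈ ρ.endRing) (hid : IsIdempotentElem e) : e = 0 ∨ e = 1 := by
  have he' (w : X) : e (w - e w) = 0 := by
    rw [map_sub, ← Module.End.mul_apply, hid.eq, sub_self]
  refine (hρ.2 _ _ (LinearMap.IsIdempotentElem.isCompl hid) fun a => le_antisymm (fun w hw => ?_)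
    (sup_le inf_le_left inf_le_left)).imp LinearMap.range_eq_bot.1 fun h =>
      LinearMap.ext fun w => ?_
  · rw [← add_sub_cancel (e w) w]
    exact Submodule.add_mem_sup ⟨he a hw, w, rfl⟩ ⟨sub_mem hw (he a hw), he' w⟩
  · exact (sub_eq_zero.1 (LinearMap.ker_eq_bot'.1 h _ (he' w))).symm

theorem indecomposable_of_eq_zero_or_one [Nontrivial X] {ρ : LinRep K X}
    (h : ∀ e ∈ ρ.endRing, IsIdempotentElem e → e = 0 ∨ e = 1) : ρ.Indecomposable := by
  refine ⟨‹_›, fun U V hUV hρ => ?_⟩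
  have he : U.projection V hUV ∈ ρ.endRing := fun a => by
    rw [mem_invtSubmodule]
    conv_lhs => rw [hρ a]
    refine sup_le (fun w hw => ?_) fun w hw => ?_
    · rw [Submodule.mem_comap, Submodule.projection_apply_of_mem_left hUV hw.2]
      exact hw.1
    · rw [Submodule.mem_comap, (Submodule.projection_apply_eq_zero_iff hUV).2 hw.2]
      exact zero_mem _
  refine (h _ he (Submodule.isIdempotentElem_projection hUV)).imp (fun h => ?_) fun h => ?_
  · rw [← Submodule.range_projection hUV, h, LinearMap.range_zero]
  · rw [← Submodule.ker_projection hUV, h, Module.End.one_eq_id, LinearMap.ker_id]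

theorem indecomposable_iff {ρ : LinRep K X} :
    ρ.Indecomposable ↔ Nontrivial ρ.endRing ∧
      ∀ e : ρ.endRing, IsIdempotentElem e → e = 0 ∨ e = 1 := by
  have hX : Nontrivial X ↔ Nontrivial ρ.endRing := by
    rw [← not_subsingleton_iff_nontrivial, ← not_subsingleton_iff_nontrivial, not_iff_not]
    refine ⟨fun h => inferInstance, fun h => ⟨fun v w => ?_⟩⟩
    have h₁ : (1 : Module.End K X) = 0 := congrArg Subtype.val (Subsingleton.elim (1 : ρ.endRing) 0)
    rw [← Module.End.one_apply (R := K) v, ← Module.End.one_apply (R := K) w, h₁]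
    rfl
  refine ⟨fun h => ⟨hX.1 h.1, fun e he => ?_⟩, fun ⟨h₁, h⟩ => ?_⟩
  · exact (h.eq_zero_or_one e.2 (congrArg Subtype.val he)).imp Subtype.ext Subtype.ext
  · have := hX.2 h₁
    exact indecomposable_of_eq_zero_or_one fun e he hid =>
      (h ⟨e, he⟩ (Subtype.ext hid)).imp (congrArg Subtype.val) (congrArg Subtype.val)

theorem indecomposable_congr {ρ : LinRep K X} {ρ' : LinRep K X'} (φ : ρ.endRing ≃+* ρ'.endRing) :
    ρ.Indecomposable ↔ ρ'.Indecomposable := by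
  rw [indecomposable_iff, indecomposable_iff, φ.toEquiv.nontrivial_congr]
  refine and_congr_right fun _ => φ.toEquiv.forall_congr fun {e} => ?_
  simp only [IsIdempotentElem, RingEquiv.toEquiv_eq_coe, RingEquiv.coe_toEquiv, ← map_mul,
    EmbeddingLike.apply_eq_iff_eq, EmbeddingLike.map_eq_zero_iff, EmbeddingLike.map_eq_one_iff]

/-- Isomorphic representations have isomorphic endomorphism rings, by conjugation. -/
def Iso.endRingEquiv {ρ : LinRep K X} {ρ' : LinRep K X'} (e : Iso ρ ρ') :
    ρ.endRing ≃+* ρ'.endRing :=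
  e.toLinearEquiv.conjRingEquiv.restrict _ _ fun f => forall_congr' fun a => by
    rw [← e.map_apply]
    exact LinearEquiv.map_mem_invtSubmodule_conj_iff.symm

theorem exists_mem_or_le_ker {f : Module.Dual K X} (hf : f ≠ 0) {P Q : Submodule K X}
    (h : P ≤ Q) :
    ∃ v, f v ≠ 0 ∧ (v ∈ P ∨ P ≤ LinearMap.ker f) ∧ (v ∈ Q ∨ Q ≤ LinearMap.ker f) := by
  by_cases hP : P ≤ LinearMap.ker f
  · by_cases hQ : Q ≤ LinearMap.ker f
    · obtain ⟨v, hv⟩ := DFunLike.ne_iff.1 hf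
      exact ⟨v, hv, .inr hP, .inr hQ⟩
    · obtain ⟨v, hv, hfv⟩ := SetLike.not_le_iff_exists.1 hQ
      exact ⟨v, hfv, .inr hP, .inl hv⟩
  · obtain ⟨v, hv, hfv⟩ := SetLike.not_le_iff_exists.1 hP
    exact ⟨v, hfv, .inl hv, .inl (h hv)⟩

theorem exists_dual_mem_or_le_ker {v : X} (hv : v ≠ 0) {P Q : Submodule K X} (h : P ≤ Q) :
    ∃ f : Module.Dual K X, f v ≠ 0 ∧ (v ∈ P ∨ P ≤ LinearMap.ker f) ∧
      (v ∈ Q ∨ Q ≤ LinearMap.ker f) := by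
  by_cases hQ : v ∈ Q
  · by_cases hP : v ∈ P
    · obtain ⟨f, hf⟩ := Module.Projective.exists_dual_ne_zero K hv
      exact ⟨f, hf, .inl hP, .inl hQ⟩
    · obtain ⟨f, hf, hP'⟩ := Submodule.exists_le_ker_of_notMem hP
      exact ⟨f, hf, .inr hP', .inl hQ⟩
  · obtain ⟨f, hf, hQ'⟩ := Submodule.exists_le_ker_of_notMem hQ
    exact ⟨f, hf, .inr (h.trans hQ'), .inr hQ'⟩

theorem Indecomposable.isSimpleModule {ρ : LinRep K X} (hρ : ρ.Indecomposable)
    {f : Module.Dual K X} {v : X} (hv : f v ≠ 0)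
    (hx : ∀ i, v ∈ ρ (x i) ∨ ρ (x i) ≤ LinearMap.ker f)
    (hy : ∀ i, v ∈ ρ (y i) ∨ ρ (y i) ≤ LinearMap.ker f) : IsSimpleModule K X := by
  -- A multiple of the rank one map `w ↦ f w • v` is an idempotent endomorphism of `ρ`.
  let e : Module.End K X := f.smulRight ((f v)⁻¹ • v)
  have hev : e v = v := by simp [e, hv]
  have hinv (W : Submodule K X) (hW : v ∈ W ∨ W ≤ LinearMap.ker f) : W ∈ e.invtSubmodule := by
    intro w hw
    rcases hW with hvW | hW
    · exact W.smul_mem _ (W.smul_mem _ hvW)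
    · simp [e, LinearMap.mem_ker.1 (hW hw)]
  have hid : IsIdempotentElem e := LinearMap.ext fun w => by simp [e, hv]
  have hv0 : v ≠ 0 := fun h => hv (by rw [h, map_zero])
  rw [isSimpleModule_iff_finrank_eq_one, finrank_eq_one_iff_of_nonzero' v hv0]
  rcases hρ.eq_zero_or_one (mem_endRing.2 fun i => ⟨hinv _ (hx i), hinv _ (hy i)⟩) hid with h | h
  · rw [h] at hev
    exact absurd hev.symm hv0
  · refine fun w => ⟨f w * (f v)⁻¹, ?_⟩
    rw [mul_smul]
    exact LinearMap.congr_fun h w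

end LinRep
end D222

/-! ## The Coxeter functor -/

namespace D222

/-- The indices `i`, `j`, `k` are distinct, that is, `{i, j, k} = {1, 2, 3}` in the notation of the
paper. -/
structure Distinct (i j k : Fin 3) : Prop where
  ij : i ≠ j
  jk : j ≠ k
  ik : i ≠ k

namespace Distinct

variable {i j k : Fin 3}

theorem rot (h : Distinct i j k) : Distinct j k i := ⟨h.jk, h.ik.symm, h.ij.symm⟩

theorem swap (h : Distinct i j k) : Distinct i k j := ⟨h.ik, h.jk.symm, h.ij⟩

theorem add_one_add_two (i : Fin 3) : Distinct i (i + 1) (i + 2) := by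
  constructor <;> revert i <;> decide

theorem exists_left (h : j ≠ k) : ∃ i, Distinct i j k := by
  have : ∀ j k : Fin 3, j ≠ k → ∃ i, i ≠ j ∧ i ≠ k := by decide
  obtain ⟨i, hij, hik⟩ := this j k h
  exact ⟨i, hij, h, hik⟩

theorem univ_eq (h : Distinct i j k) : (Finset.univ : Finset (Fin 3)) = {i, j, k} := by
  obtain ⟨hij, hjk, hik⟩ := h
  revert i j k
  decide

theorem forall_iff (h : Distinct i j k) {p : Fin 3 → Prop} : (∀ s, p s) ↔ p i ∧ p j ∧ p k := by
  have (s : Fin 3) : s ∈ ({i, j, k} : Finset (Fin 3)) := h.univ_eq ▸ Finset.mem_univ s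
  simp only [Finset.mem_insert, Finset.mem_singleton] at this
  refine ⟨fun hp => ⟨hp i, hp j, hp k⟩, fun ⟨hi, hj, hk⟩ s => ?_⟩
  rcases this s with rfl | rfl | rfl
  exacts [hi, hj, hk]

theorem sum_eq {M : Type*} [AddCommMonoid M] (h : Distinct i j k) (η : Fin 3 → M) :
    ∑ s, η s = η i + η j + η k := by
  rw [h.univ_eq, Finset.sum_insert (by simp [h.ij, h.ik]), Finset.sum_pair h.jk, add_assoc]

theorem inf_univ_eq {L : Type*} [SemilatticeInf L] [OrderTop L] (h : Distinct i j k)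
    (η : Fin 3 → L) : Finset.univ.inf η = η i ⊓ η j ⊓ η k := by
  rw [h.univ_eq, Finset.inf_insert, Finset.inf_insert, Finset.inf_singleton, inf_assoc]

end Distinct

namespace LinRep

variable {K : Type u} [Field K] {X : Type u} [AddCommGroup X] [Module K X]

/-- The space `{(η₁, η₂, η₃) | η_i ∈ ρ(y_i), η₁ + η₂ + η₃ = 0}` of the representation `Φ⁺ρ`. -/
def coxSpace (ρ : LinRep K X) : Submodule K (Fin 3 → X) :=
  Submodule.pi Set.univ (fun i => ρ (y i)) ⊓ LinearMap.ker (∑ i, LinearMap.proj i)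

theorem mem_coxSpace {ρ : LinRep K X} {η : Fin 3 → X} :
    η ∈ ρ.coxSpace ↔ (∀ i, η i ∈ ρ (y i)) ∧ ∑ i, η i = 0 := by
  simp [coxSpace, LinearMap.sum_apply]

/-- The projection `φ_i` of the space of `Φ⁺ρ` to the space of `ρ`. -/
def proj (ρ : LinRep K X) (i : Fin 3) : ρ.coxSpace →ₗ[K] X :=
  LinearMap.proj i ∘ₗ ρ.coxSpace.subtype

/-- The representation `Φ⁺ρ` obtained from `ρ` by the Coxeter functor `Φ⁺`. -/
def cox (ρ : LinRep K X) : LinRep K ρ.coxSpace :=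
  ofChains (fun i => (⊥ : Submodule K X).comap (ρ.proj i)) (fun i => (ρ (x i)).comap (ρ.proj i))
    fun _ => Submodule.comap_mono bot_le

variable (ρ : LinRep K X) {i j k : Fin 3}

theorem cox_x (i : Fin 3) : ρ.cox (x i) = (⊥ : Submodule K X).comap (ρ.proj i) :=
  ofChains_x ..

theorem cox_y (i : Fin 3) : ρ.cox (y i) = (ρ (x i)).comap (ρ.proj i) := ofChains_y ..

theorem proj_mem (i : Fin 3) (η : ρ.coxSpace) : ρ.proj i η ∈ ρ (y i) := (mem_coxSpace.1 η.2).1 i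

theorem sum_proj (η : ρ.coxSpace) : ∑ i, ρ.proj i η = 0 := (mem_coxSpace.1 η.2).2

theorem coxSpace_ext {η ζ : ρ.coxSpace} (h : ∀ i, ρ.proj i η = ρ.proj i ζ) : η = ζ :=
  Subtype.ext (funext h)

theorem exists_proj (h : Distinct i j k) {a b c : X} (ha : a ∈ ρ (y i)) (hb : b ∈ ρ (y j))
    (hc : c ∈ ρ (y k)) (h0 : a + b + c = 0) :
    ∃ η : ρ.coxSpace, ρ.proj i η = a ∧ ρ.proj j η = b ∧ ρ.proj k η = c := by
  set η : Fin 3 → X := fun s => if s = i then a else if s = j then b else c with hη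
  have hi : η i = a := by simp [hη]
  have hj : η j = b := by simp [hη, h.ij.symm]
  have hk : η k = c := by simp [hη, h.ik.symm, h.jk.symm]
  refine ⟨⟨η, mem_coxSpace.2 ⟨h.forall_iff.2 ⟨hi ▸ ha, hj ▸ hb, hk ▸ hc⟩, ?_⟩⟩, hi, hj, hk⟩
  rw [h.sum_eq, hi, hj, hk, h0]

theorem map_proj_inf_comap (h : Distinct i j k) (P Q R : Submodule K X) :
    (P.comap (ρ.proj i) ⊓ Q.comap (ρ.proj j) ⊓ R.comap (ρ.proj k)).map (ρ.proj k) =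
      ρ (y k) ⊓ R ⊓ (ρ (y i) ⊓ P ⊔ ρ (y j) ⊓ Q) := by
  refine le_antisymm ?_ ?_
  · rintro _ ⟨η, ⟨⟨hP, hQ⟩, hR⟩, rfl⟩
    have hsum : ρ.proj k η = -(ρ.proj i η + ρ.proj j η) := by
      rw [eq_neg_iff_add_eq_zero, add_comm, ← h.sum_eq fun s => ρ.proj s η, ρ.sum_proj]
    refine ⟨⟨ρ.proj_mem k η, hR⟩, hsum ▸ neg_mem (Submodule.add_mem_sup ?_ ?_)⟩
    exacts [⟨ρ.proj_mem i η, hP⟩, ⟨ρ.proj_mem j η, hQ⟩]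
  · rintro w ⟨⟨hw, hR⟩, hw'⟩
    obtain ⟨a, ⟨ha, haP⟩, b, ⟨hb, hbQ⟩, rfl⟩ := Submodule.mem_sup.1 hw'
    obtain ⟨η, hi, hj, hk⟩ := ρ.exists_proj h (neg_mem ha) (neg_mem hb) hw (by abel)
    refine ⟨η, ⟨⟨?_, ?_⟩, ?_⟩, hk⟩ <;> rw [SetLike.mem_coe, Submodule.mem_comap]
    exacts [hi ▸ neg_mem haP, hj ▸ neg_mem hbQ, hk ▸ hR]

theorem comap_proj_sup (h : Distinct i j k) {P : Submodule K X} (hP : P ≤ ρ (y i))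
    (Q R : Submodule K X) :
    P.comap (ρ.proj i) ⊔ Q.comap (ρ.proj j) ⊓ R.comap (ρ.proj k) =
      (P ⊔ (ρ (y j) ⊓ Q ⊔ ρ (y k) ⊓ R)).comap (ρ.proj i) := by
  have hmap := ρ.map_proj_inf_comap h.rot Q R ⊤
  rw [Submodule.comap_top, inf_top_eq, inf_top_eq] at hmap
  have hcomap (Z : Submodule K X) : (ρ (y i) ⊓ Z).comap (ρ.proj i) = Z.comap (ρ.proj i) := by
    rw [Submodule.comap_inf, inf_eq_right]
    exact fun η _ => ρ.proj_mem i η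
  rw [← Submodule.comap_map_sup_of_comap_le (f := ρ.proj i) (q := P) le_sup_left, Submodule.map_sup,
    sup_comm, ← sup_assoc, sup_eq_left.2 (Submodule.map_comap_le _ P), hmap, ← hcomap (P ⊔ (_ ⊔ _)),
    inf_comm (ρ (y i)) (P ⊔ _), sup_inf_assoc_of_le _ hP, inf_comm _ (ρ (y i))]

theorem cox_AAtom_and_aAtom (n : ℕ) : ∀ {i j k : Fin 3}, Distinct i j k →
    ρ.cox (AAtom n i j k) = (ρ (aAtom n i k j)).comap (ρ.proj i) ∧
      ρ.cox (aAtom n i j k) = (ρ (AAtom n k j i)).comap (ρ.proj i) := by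
  induction n with
  | zero => simp [AAtom, aAtom]
  | succ n ih =>
    intro i j k h
    constructor
    · rw [AAtom, aAtom, map_sup, map_inf, (ih h.rot.rot).1, cox_y, cox_x,
        ρ.comap_proj_sup h (ρ.x_le_y i), inf_bot_eq, bot_sup_eq, map_sup, map_inf]
    · have hsup := ρ.comap_proj_sup h bot_le (ρ (x j) ⊓ ρ (AAtom n i k j)) ⊤
      rw [Submodule.comap_top, inf_top_eq, inf_top_eq, bot_sup_eq, sup_comm (_ ⊓ _), ← inf_assoc,
        inf_eq_right.2 (ρ.x_le_y j)] at hsup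
      rw [AAtom, aAtom, map_sup, map_inf, (ih h.rot).2, cox_y, cox_x, ← Submodule.comap_inf, hsup,
        map_sup, map_inf]

theorem cox_x_sup_x (h : Distinct i j k) :
    ρ.cox (x i ⊔ x j) = (ρ (y k)).comap (ρ.proj i) := by
  simpa [cox_x] using ρ.comap_proj_sup h bot_le ⊥ ⊤

/-! ## Full faithfulness of the Coxeter functor -/

/-- Any two of the three subspaces `ρ(y_i)` span the space. -/
def Spanning (ρ : LinRep K X) : Prop := Pairwise fun i j => Codisjoint (ρ (y i)) (ρ (y j))

variable {ρ}

theorem Spanning.map_proj (hs : ρ.Spanning) {B : Submodule K X} (hB : B ≤ ρ (y i)) :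
    (B.comap (ρ.proj i)).map (ρ.proj i) = B := by
  have h := (Distinct.add_one_add_two i).rot
  simpa only [Submodule.comap_top, top_inf_eq, inf_top_eq, inf_eq_right.2 hB,
    (hs h.ij).eq_top] using ρ.map_proj_inf_comap h ⊤ ⊤ B

theorem Spanning.range_proj (hs : ρ.Spanning) (i : Fin 3) :
    LinearMap.range (ρ.proj i) = ρ (y i) := by
  rw [← hs.map_proj le_rfl, LinearMap.range_eq_map]
  congr 1
  exact (eq_top_iff.2 fun η _ => ρ.proj_mem i η).symm

/-- The action of `Φ⁺` on endomorphisms: an endomorphism of `ρ` acts componentwise. -/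
def coxEnd (ρ : LinRep K X) : ρ.endRing →+* ρ.cox.endRing where
  toFun f := ⟨(f.1.compLeft (Fin 3)).restrict fun η hη => by
      rw [mem_coxSpace] at hη ⊢
      exact ⟨fun i => f.2 _ (hη.1 i), (map_sum f.1 η _).symm.trans (by rw [hη.2, map_zero])⟩,
    mem_endRing.2 fun i => ⟨fun η hη => (congrArg f.1 hη).trans (map_zero f.1),
      fun _ hη => f.2 _ hη⟩⟩
  map_one' := rfl
  map_mul' _ _ := rfl
  map_zero' := rfl
  map_add' _ _ := rfl

theorem proj_coxEnd (f : ρ.endRing) (i : Fin 3) (η : ρ.coxSpace) :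
    ρ.proj i ((ρ.coxEnd f).1 η) = f.1 (ρ.proj i η) := rfl

theorem Spanning.coxEnd_injective (hs : ρ.Spanning) : Function.Injective ρ.coxEnd := by
  intro f g hfg
  have hle (i : Fin 3) : ρ (y i) ≤ LinearMap.eqLocus f.1 g.1 := by
    rw [← hs.range_proj]
    rintro _ ⟨η, rfl⟩
    rw [LinearMap.mem_eqLocus, ← proj_coxEnd, hfg, proj_coxEnd]
  have htop : LinearMap.eqLocus f.1 g.1 = ⊤ :=
    top_le_iff.1 (hs Fin.zero_ne_one (hle 0) (hle 1))
  exact Subtype.ext (LinearMap.eqLocus_eq_top.1 htop)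

theorem exists_comp_eq_of_ker_le {V W : Type*} [AddCommGroup V] [Module K V] [AddCommGroup W]
    [Module K W] {S : V →ₗ[K] X} (hS : Function.Surjective S) {T : V →ₗ[K] W}
    (hT : LinearMap.ker S ≤ LinearMap.ker T) : ∃ f : X →ₗ[K] W, f ∘ₗ S = T := by
  refine ⟨(LinearMap.ker S).liftQ T hT ∘ₗ (S.quotKerEquivOfSurjective hS).symm,
    LinearMap.ext fun v => ?_⟩
  have : (S.quotKerEquivOfSurjective hS).symm (S v) = Submodule.Quotient.mk v :=
    (LinearEquiv.symm_apply_eq _).2 rfl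
  simp [this]

theorem Spanning.exists_comp_proj_eq (hs : ρ.Spanning) {g : Module.End K ρ.coxSpace}
    (hg : g ∈ ρ.cox.endRing) : ∃ f : Module.End K X, ∀ i, f ∘ₗ ρ.proj i = ρ.proj i ∘ₗ g := by
  let S := LinearMap.lsum K (fun _ => ρ.coxSpace) K ρ.proj
  have hS (ζ : Fin 3 → ρ.coxSpace) : S ζ = ∑ i, ρ.proj i (ζ i) := by
    simp [S, LinearMap.lsum_apply, LinearMap.sum_apply]
  have hSsingle (i : Fin 3) (η : ρ.coxSpace) : S (Pi.single i η) = ρ.proj i η :=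
    LinearMap.lsum_piSingle ..
  have hrange (i : Fin 3) : ρ (y i) ≤ LinearMap.range S := by
    rw [← hs.range_proj]
    rintro _ ⟨η, rfl⟩
    exact ⟨Pi.single i η, hSsingle i η⟩
  have hsurj : Function.Surjective S :=
    LinearMap.range_eq_top.1 (top_le_iff.1 (hs Fin.zero_ne_one (hrange 0) (hrange 1)))
  have hker : LinearMap.ker S ≤ LinearMap.ker (S ∘ₗ g.compLeft (Fin 3)) := fun ζ hζ => by
    let ξ : ρ.coxSpace := ⟨fun i => ρ.proj i (ζ i),
      mem_coxSpace.2 ⟨fun i => ρ.proj_mem i (ζ i), (hS ζ).symm.trans hζ⟩⟩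
    have hξ (i : Fin 3) : ρ.proj i (g (ζ i)) = ρ.proj i (g ξ) := by
      have hmem : ζ i - ξ ∈ ρ.cox (x i) := sub_eq_zero.2 rfl
      have hgmem : g (ζ i - ξ) ∈ ρ.cox (x i) := hg _ hmem
      rw [map_sub g] at hgmem
      exact sub_eq_zero.1 hgmem
    simp only [LinearMap.mem_ker, LinearMap.comp_apply, LinearMap.compLeft_apply, hS,
      Function.comp_apply, hξ, sum_proj]
  obtain ⟨f, hf⟩ := exists_comp_eq_of_ker_le hsurj hker
  refine ⟨f, fun i => LinearMap.ext fun η => ?_⟩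
  have hsingle : g.compLeft (Fin 3) (Pi.single i η) = Pi.single i (g η) :=
    funext fun j => Pi.apply_single (fun _ => g) (fun _ => map_zero g) i η j
  rw [LinearMap.comp_apply, ← hSsingle, ← LinearMap.comp_apply, hf, LinearMap.comp_apply, hsingle,
    hSsingle, LinearMap.comp_apply]

theorem Spanning.coxEnd_surjective (hs : ρ.Spanning) : Function.Surjective ρ.coxEnd := by
  rintro ⟨g, hg⟩
  obtain ⟨f, hf⟩ := hs.exists_comp_proj_eq hg
  have hinv {i : Fin 3} {P : Submodule K X} (hP : P ≤ ρ (y i))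
      (hgP : P.comap (ρ.proj i) ∈ g.invtSubmodule) : P ∈ f.invtSubmodule := by
    rw [← hs.map_proj hP]
    rintro _ ⟨η, hη, rfl⟩
    exact ⟨g η, hgP hη, (LinearMap.congr_fun (hf i) η).symm⟩
  refine ⟨⟨f, mem_endRing.2 fun i => ⟨hinv (ρ.x_le_y i) (hg (y i)), hinv le_rfl ?_⟩⟩, ?_⟩
  · exact fun η _ => ρ.proj_mem i (g η)
  · exact Subtype.ext (LinearMap.ext fun η => ρ.coxSpace_ext fun i => LinearMap.congr_fun (hf i) η)

theorem Spanning.indecomposable_cox_iff (hs : ρ.Spanning) :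
    ρ.cox.Indecomposable ↔ ρ.Indecomposable :=
  (indecomposable_congr (RingEquiv.ofBijective ρ.coxEnd
    ⟨hs.coxEnd_injective, hs.coxEnd_surjective⟩)).symm

theorem Indecomposable.eq_bot_of_sup_ne_top (hρ : ρ.Indecomposable) (h : Distinct i j k)
    (hjk : ρ (y j) ⊔ ρ (y k) ≠ ⊤) : IsSimpleModule K X ∧ ρ (y j) = ⊥ ∧ ρ (y k) = ⊥ := by
  obtain ⟨f, hf, hle⟩ := Submodule.exists_le_ker_of_lt_top _ (lt_top_iff_ne_top.2 hjk)
  obtain ⟨v, hv, hx, hy⟩ := exists_mem_or_le_ker hf (ρ.x_le_y i)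
  have hyj : ρ (y j) ≤ LinearMap.ker f := le_sup_left.trans hle
  have hyk : ρ (y k) ≤ LinearMap.ker f := le_sup_right.trans hle
  have hsimple : IsSimpleModule K X := hρ.isSimpleModule hv
    (h.forall_iff.2 ⟨hx, .inr ((ρ.x_le_y j).trans hyj), .inr ((ρ.x_le_y k).trans hyk)⟩)
    (h.forall_iff.2 ⟨hy, .inr hyj, .inr hyk⟩)
  have hker : LinearMap.ker f = ⊥ := (eq_bot_or_eq_top _).resolve_right fun htop =>
    hf (LinearMap.ker_eq_top.1 htop)
  exact ⟨hsimple, eq_bot_iff.2 (hker ▸ hyj), eq_bot_iff.2 (hker ▸ hyk)⟩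

theorem Indecomposable.spanning_or (hρ : ρ.Indecomposable) :
    ρ.Spanning ∨ IsSimpleModule K X ∧ ∃ i, ∀ s ≠ i, ρ (y s) = ⊥ := by
  refine or_iff_not_imp_left.2 fun hs => ?_
  simp only [Spanning, Pairwise, not_forall, codisjoint_iff] at hs
  obtain ⟨j, k, hjk, hne⟩ := hs
  obtain ⟨i, h⟩ := Distinct.exists_left hjk
  obtain ⟨hsimple, hj, hk⟩ := hρ.eq_bot_of_sup_ne_top h hne
  exact ⟨hsimple, i, h.forall_iff.2 ⟨fun hi => absurd rfl hi, fun _ => hj, fun _ => hk⟩⟩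

end LinRep
end D222

/-! ## Atomic elements and the Coxeter functor -/

namespace D222

theorem x_le_AAtom (n : ℕ) (i j k : Fin 3) : x i ≤ AAtom n i j k := by
  cases n with
  | zero => exact le_top
  | succ n => exact (x_le_y i).trans le_sup_left

theorem y_le_AAtom (n : ℕ) (i j k : Fin 3) : y i ≤ AAtom n i j k := by
  cases n with
  | zero => exact le_top
  | succ n => exact le_sup_left

theorem x_le_aAtom_left (n : ℕ) (i j k : Fin 3) : x i ≤ aAtom n i j k := by
  cases n with
  | zero => exact le_top
  | succ n => exact le_sup_left

theorem x_le_aAtom_right (n : ℕ) (i j k : Fin 3) : x j ≤ aAtom n i j k := by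
  cases n with
  | zero => exact le_top
  | succ n => exact (le_inf (x_le_y j) (x_le_aAtom_left n j k i)).trans le_sup_right

/-- The element `e_α` for a word `α` with first letter `i` in which (reading from the right) `u`
letters are followed by their successor and `v` by their predecessor, for the cyclic order
`i → j → k → i`. -/
def eForm (u v : ℕ) (i j k : Fin 3) : D222 :=
  y i ⊓ AAtom (v / 2) j i k ⊓ AAtom ((v + 1) / 2) k j i ⊓ aAtom (u / 2) i k j ⊓
    aAtom ((u + 1) / 2) k j i

/-- The element `f_α` for a word `α` as in `eForm`. -/
def fForm (u v : ℕ) (i j k : Fin 3) : D222 :=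
  if u % 2 = 0 then
    if v % 2 = 0 then x i ⊓ AAtom (v / 2) k j i ⊓ aAtom (u / 2) k j i
    else y i ⊓ y k ⊓ aAtom (u / 2) k j i ⊓ AAtom (v / 2) j i k
  else
    if v % 2 = 0 then y i ⊓ y j ⊓ aAtom (u / 2) i k j ⊓ AAtom (v / 2) k j i
    else y i ⊓ (x j ⊔ x k) ⊓ AAtom (v / 2) j i k ⊓ aAtom (u / 2) i k j

section

variable (a b : ℕ) (i j k : Fin 3)

theorem fForm_even_even :
    fForm (2 * a) (2 * b) i j k = x i ⊓ AAtom b k j i ⊓ aAtom a k j i := by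
  rw [fForm, if_pos (by lia), if_pos (by lia), show 2 * a / 2 = a by lia,
    show 2 * b / 2 = b by lia]

theorem fForm_even_odd :
    fForm (2 * a) (2 * b + 1) i j k = y i ⊓ y k ⊓ aAtom a k j i ⊓ AAtom b j i k := by
  rw [fForm, if_pos (by lia), if_neg (by lia), show 2 * a / 2 = a by lia,
    show (2 * b + 1) / 2 = b by lia]

theorem fForm_odd_even :
    fForm (2 * a + 1) (2 * b) i j k = y i ⊓ y j ⊓ aAtom a i k j ⊓ AAtom b k j i := by
  rw [fForm, if_neg (by lia), if_pos (by lia), show (2 * a + 1) / 2 = a by lia,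
    show 2 * b / 2 = b by lia]

theorem fForm_odd_odd : fForm (2 * a + 1) (2 * b + 1) i j k =
    y i ⊓ (x j ⊔ x k) ⊓ AAtom b j i k ⊓ aAtom a i k j := by
  rw [fForm, if_neg (by lia), if_neg (by lia), show (2 * a + 1) / 2 = a by lia,
    show (2 * b + 1) / 2 = b by lia]

theorem eForm_even_even : eForm (2 * a) (2 * b) i j k =
    y i ⊓ AAtom b j i k ⊓ AAtom b k j i ⊓ aAtom a i k j ⊓ aAtom a k j i := by
  rw [eForm, show 2 * a / 2 = a by lia, show 2 * b / 2 = b by lia,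
    show (2 * a + 1) / 2 = a by lia, show (2 * b + 1) / 2 = b by lia]

theorem eForm_even_odd : eForm (2 * a) (2 * b + 1) i j k =
    y i ⊓ AAtom b j i k ⊓ AAtom (b + 1) k j i ⊓ aAtom a i k j ⊓ aAtom a k j i := by
  rw [eForm, show 2 * a / 2 = a by lia, show (2 * b + 1) / 2 = b by lia,
    show (2 * a + 1) / 2 = a by lia, show (2 * b + 1 + 1) / 2 = b + 1 by lia]

theorem eForm_odd_even : eForm (2 * a + 1) (2 * b) i j k =
    y i ⊓ AAtom b j i k ⊓ AAtom b k j i ⊓ aAtom a i k j ⊓ aAtom (a + 1) k j i := by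
  rw [eForm, show (2 * a + 1) / 2 = a by lia, show 2 * b / 2 = b by lia,
    show (2 * a + 1 + 1) / 2 = a + 1 by lia, show (2 * b + 1) / 2 = b by lia]

theorem eForm_odd_odd : eForm (2 * a + 1) (2 * b + 1) i j k =
    y i ⊓ AAtom b j i k ⊓ AAtom (b + 1) k j i ⊓ aAtom a i k j ⊓ aAtom (a + 1) k j i := by
  rw [eForm, show (2 * a + 1) / 2 = a by lia, show (2 * b + 1) / 2 = b by lia,
    show (2 * a + 1 + 1) / 2 = a + 1 by lia, show (2 * b + 1 + 1) / 2 = b + 1 by lia]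

theorem fForm_zero : fForm 0 0 i j k = x i := by
  simp [fForm, AAtom, aAtom]

theorem eForm_zero : eForm 0 0 i j k = y i := by
  simp [eForm, AAtom, aAtom]

end

namespace LinRep

variable {K : Type u} [Field K] {X : Type u} [AddCommGroup X] [Module K X] (ρ : LinRep K X)
  {i j k : Fin 3}

theorem cox_AAtom (h : Distinct i j k) (n : ℕ) :
    ρ.cox (AAtom n i j k) = (ρ (aAtom n i k j)).comap (ρ.proj i) :=
  (ρ.cox_AAtom_and_aAtom n h).1

theorem cox_aAtom (h : Distinct i j k) (n : ℕ) :
    ρ.cox (aAtom n i j k) = (ρ (AAtom n k j i)).comap (ρ.proj i) :=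
  (ρ.cox_AAtom_and_aAtom n h).2

theorem map_proj_of_cox_eq (h : Distinct i j k) {z p q r : D222} (hz : ρ.cox z =
    (ρ p).comap (ρ.proj i) ⊓ (ρ q).comap (ρ.proj j) ⊓ (ρ r).comap (ρ.proj k)) :
    (ρ.cox z).map (ρ.proj k) = ρ (y k ⊓ r ⊓ (y i ⊓ p ⊔ y j ⊓ q)) := by
  rw [hz, ρ.map_proj_inf_comap h]
  simp only [map_inf, map_sup]

theorem map_proj_cox_fForm_even_even (h : Distinct i j k) (a b : ℕ) :
    (ρ.cox (fForm (2 * a) (2 * b) i j k)).map (ρ.proj j) = ρ (fForm (2 * b) (2 * a + 1) j i k) ∧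
      (ρ.cox (fForm (2 * a) (2 * b) i j k)).map (ρ.proj k) =
        ρ (fForm (2 * b + 1) (2 * a) k j i) := by
  have hz : ρ.cox (fForm (2 * a) (2 * b) i j k) = (⊥ : Submodule K X).comap (ρ.proj i) ⊓
      (⊤ : Submodule K X).comap (ρ.proj j) ⊓
      (ρ (aAtom b k i j ⊓ AAtom a i j k)).comap (ρ.proj k) := by
    rw [fForm_even_even, map_inf, map_inf, ρ.cox_AAtom h.swap.rot, ρ.cox_aAtom h.swap.rot, cox_x,
      Submodule.comap_top, inf_top_eq, inf_assoc, map_inf, Submodule.comap_inf]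
  constructor
  · rw [hz, inf_comm, ← inf_assoc, ρ.map_proj_inf_comap h.rot.rot, fForm_even_odd]
    simp only [map_inf, inf_bot_eq, inf_top_eq, sup_bot_eq]
    ac_rfl
  · rw [hz, ρ.map_proj_inf_comap h, fForm_odd_even]
    simp only [map_inf, inf_bot_eq, inf_top_eq, bot_sup_eq]
    ac_rfl

theorem map_proj_cox_fForm_even_odd (h : Distinct i j k) (a b : ℕ) :
    (ρ.cox (fForm (2 * a) (2 * b + 1) i j k)).map (ρ.proj j) =
        ρ (fForm (2 * b + 1) (2 * a + 1) j i k) ∧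
      (ρ.cox (fForm (2 * a) (2 * b + 1) i j k)).map (ρ.proj k) =
        ρ (fForm (2 * (b + 1)) (2 * a) k j i) := by
  have hz : ρ.cox (fForm (2 * a) (2 * b + 1) i j k) = (ρ (x i)).comap (ρ.proj i) ⊓
      (ρ (aAtom b j k i)).comap (ρ.proj j) ⊓ (ρ (x k ⊓ AAtom a i j k)).comap (ρ.proj k) := by
    rw [fForm_even_odd, map_inf, map_inf, map_inf, ρ.cox_AAtom h.swap.rot.rot,
      ρ.cox_aAtom h.swap.rot, cox_y, cox_y, map_inf, Submodule.comap_inf]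
    ac_rfl
  have hk : x k ⊓ AAtom a i j k ≤ y k := inf_le_left.trans (D222.x_le_y k)
  constructor
  · rw [ρ.map_proj_of_cox_eq h.rot.rot (p := x k ⊓ AAtom a i j k) (q := x i)
      (r := aAtom b j k i) (by rw [hz]; ac_rfl), inf_eq_right.2 hk, inf_eq_right.2 (D222.x_le_y i),
      inf_comm (x k), inf_sup_assoc_of_le _ (x_le_AAtom a i j k), fForm_odd_odd, sup_comm (x i)]
    congr 1
    ac_rfl
  · rw [ρ.map_proj_of_cox_eq h hz, inf_eq_right.2 hk, inf_eq_right.2 (D222.x_le_y i),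
      fForm_even_even, aAtom]

theorem map_proj_cox_fForm_odd_even (h : Distinct i j k) (a b : ℕ) :
    (ρ.cox (fForm (2 * a + 1) (2 * b) i j k)).map (ρ.proj j) =
        ρ (fForm (2 * b) (2 * (a + 1)) j i k) ∧
      (ρ.cox (fForm (2 * a + 1) (2 * b) i j k)).map (ρ.proj k) =
        ρ (fForm (2 * b + 1) (2 * a + 1) k j i) := by
  have hz : ρ.cox (fForm (2 * a + 1) (2 * b) i j k) =
      (ρ (x i ⊓ AAtom a j k i)).comap (ρ.proj i) ⊓ (ρ (x j)).comap (ρ.proj j) ⊓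
        (ρ (aAtom b k i j)).comap (ρ.proj k) := by
    rw [fForm_odd_even, map_inf, map_inf, map_inf, ρ.cox_AAtom h.swap.rot, ρ.cox_aAtom h.swap,
      cox_y, cox_y, map_inf, Submodule.comap_inf]
    ac_rfl
  have hi : x i ⊓ AAtom a j k i ≤ y i := inf_le_left.trans (D222.x_le_y i)
  constructor
  · rw [ρ.map_proj_of_cox_eq h.rot.rot (p := aAtom b k i j) (q := x i ⊓ AAtom a j k i)
      (r := x j) (by rw [hz]; ac_rfl), inf_eq_right.2 hi, inf_eq_right.2 (D222.x_le_y j),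
      inf_comm (y k), inf_sup_assoc_of_le _ (inf_le_left.trans (x_le_aAtom_right b k i j)),
      fForm_even_even, AAtom]
    congr 1
    ac_rfl
  · rw [ρ.map_proj_of_cox_eq h hz, inf_eq_right.2 hi, inf_eq_right.2 (D222.x_le_y j),
      inf_comm (x i), inf_sup_assoc_of_le _ ((D222.x_le_y j).trans (y_le_AAtom a j k i)),
      fForm_odd_odd, sup_comm (x j)]
    congr 1
    ac_rfl

theorem map_proj_cox_fForm_odd_odd (h : Distinct i j k) (a b : ℕ) :
    (ρ.cox (fForm (2 * a + 1) (2 * b + 1) i j k)).map (ρ.proj j) =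
        ρ (fForm (2 * b + 1) (2 * (a + 1)) j i k) ∧
      (ρ.cox (fForm (2 * a + 1) (2 * b + 1) i j k)).map (ρ.proj k) =
        ρ (fForm (2 * (b + 1)) (2 * a + 1) k j i) := by
  have hz : ρ.cox (fForm (2 * a + 1) (2 * b + 1) i j k) = ρ.cox (x j ⊔ x k) ⊓
      ((ρ (x i ⊓ AAtom a j k i)).comap (ρ.proj i) ⊓ (ρ (aAtom b j k i)).comap (ρ.proj j)) := by
    rw [fForm_odd_odd, map_inf, map_inf, map_inf, ρ.cox_AAtom h.swap.rot.rot, ρ.cox_aAtom h.swap,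
      cox_y, map_inf, Submodule.comap_inf]
    ac_rfl
  have hi : x i ⊓ AAtom a j k i ≤ y i := inf_le_left.trans (D222.x_le_y i)
  constructor
  · have hj : ρ.cox (fForm (2 * a + 1) (2 * b + 1) i j k) = (ρ ⊤).comap (ρ.proj k) ⊓
        (ρ (x i ⊓ AAtom a j k i)).comap (ρ.proj i) ⊓
          (ρ (y i ⊓ aAtom b j k i)).comap (ρ.proj j) := by
      rw [hz, ρ.cox_x_sup_x h.rot, apply_top, Submodule.comap_top, top_inf_eq,
        map_inf ρ.toLatticeHom (y i), Submodule.comap_inf, inf_left_comm]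
    rw [ρ.map_proj_of_cox_eq h.rot.rot hj, inf_eq_right.2 hi, inf_top_eq, fForm_odd_even, AAtom,
      ← inf_assoc (y j)]
  · have hk : ρ.cox (fForm (2 * a + 1) (2 * b + 1) i j k) =
        (ρ (x i ⊓ AAtom a j k i)).comap (ρ.proj i) ⊓
          (ρ (aAtom b j k i)).comap (ρ.proj j) ⊓ (ρ (y i)).comap (ρ.proj k) := by
      rw [hz, sup_comm, ρ.cox_x_sup_x h.swap.rot, inf_comm]
    rw [ρ.map_proj_of_cox_eq h hk, inf_eq_right.2 hi,
      inf_comm (x i), inf_sup_assoc_of_le _ (inf_le_left.trans (y_le_AAtom a j k i)),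
      fForm_even_odd, aAtom]
    congr 1
    ac_rfl

theorem map_proj_cox_eForm (h : Distinct i j k) (u v : ℕ) :
    (ρ.cox (eForm u v i j k)).map (ρ.proj j) = ρ (eForm v (u + 1) j i k) ∧
      (ρ.cox (eForm u v i j k)).map (ρ.proj k) = ρ (eForm (v + 1) u k j i) := by
  have hz : ρ.cox (eForm u v i j k) =
      (ρ (x i ⊓ AAtom (u / 2) j k i)).comap (ρ.proj i) ⊓
        (ρ (aAtom (v / 2) j k i)).comap (ρ.proj j) ⊓
        (ρ (aAtom ((v + 1) / 2) k i j ⊓ AAtom ((u + 1) / 2) i j k)).comap (ρ.proj k) := by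
    simp only [eForm, map_inf, Submodule.comap_inf]
    rw [ρ.cox_AAtom h.swap.rot.rot, ρ.cox_AAtom h.swap.rot, ρ.cox_aAtom h.swap,
      ρ.cox_aAtom h.swap.rot, cox_y]
    ac_rfl
  have hi : x i ⊓ AAtom (u / 2) j k i ≤ y i := inf_le_left.trans (D222.x_le_y i)
  constructor
  · rw [ρ.map_proj_of_cox_eq h.rot.rot
      (p := aAtom ((v + 1) / 2) k i j ⊓ AAtom ((u + 1) / 2) i j k)
      (q := x i ⊓ AAtom (u / 2) j k i) (r := aAtom (v / 2) j k i) (by rw [hz]; ac_rfl),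
      inf_eq_right.2 hi, inf_comm (y k), inf_sup_assoc_of_le _
        (le_inf (inf_le_left.trans (x_le_aAtom_right _ k i j))
          (inf_le_left.trans (x_le_AAtom _ i j k))), eForm,
      show (u + 1 + 1) / 2 = u / 2 + 1 by lia, AAtom.eq_2]
    congr 1
    ac_rfl
  · rw [ρ.map_proj_of_cox_eq h hz, inf_eq_right.2 hi, inf_comm (x i),
      inf_sup_assoc_of_le _ (inf_le_left.trans (y_le_AAtom (u / 2) j k i)), eForm,
      show (v + 1 + 1) / 2 = v / 2 + 1 by lia, aAtom.eq_2]
    congr 1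
    ac_rfl

end LinRep

/-- A family of elements `F u v i j k`, attached to the words as in `eForm`, which is carried to
itself by the Coxeter functor: the `j`-th (`k`-th) projection turns the element of a word with first
letter `i` into that of the word with the additional first letter `j` (`k`). -/
structure IsStepFamily (K : Type u) [Field K] (F : ℕ → ℕ → Fin 3 → Fin 3 → Fin 3 → D222) :
    Prop where
  zero_zero : ∀ i j k, F 0 0 i j k = F 0 0 i k j
  map_proj_cox : ∀ {X : Type u} [AddCommGroup X] [Module K X] (ρ : LinRep K X) {i j k : Fin 3},
    Distinct i j k → ∀ u v : ℕ,
      (ρ.cox (F u v i j k)).map (ρ.proj j) = ρ (F v (u + 1) j i k) ∧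
        (ρ.cox (F u v i j k)).map (ρ.proj k) = ρ (F (v + 1) u k j i)

namespace IsStepFamily

variable {K : Type u} [Field K]

theorem eForm : IsStepFamily K eForm where
  zero_zero i j k := by rw [eForm_zero, eForm_zero]
  map_proj_cox ρ _ _ _ h u v := ρ.map_proj_cox_eForm h u v

theorem fForm : IsStepFamily K fForm where
  zero_zero i j k := by rw [fForm_zero, fForm_zero]
  map_proj_cox ρ _ _ _ h u v := by
    obtain ⟨a, rfl | rfl⟩ := u.even_or_odd' <;> obtain ⟨b, rfl | rfl⟩ := v.even_or_odd'
    · exact ρ.map_proj_cox_fForm_even_even h a b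
    · exact ρ.map_proj_cox_fForm_even_odd h a b
    · exact ρ.map_proj_cox_fForm_odd_even h a b
    · exact ρ.map_proj_cox_fForm_odd_odd h a b

variable {F : ℕ → ℕ → Fin 3 → Fin 3 → Fin 3 → D222}

-- The word with parameters `u`, `v` for the cyclic order `i → j → k → i` is the word with
-- parameters `v`, `u` for the opposite order.
theorem apply_symm (hF : IsStepFamily K F) {u v : ℕ} : ∀ {X : Type u} [AddCommGroup X]
    [Module K X] (ρ : LinRep K X) {i j k : Fin 3}, Distinct i j k →
      ρ (F u v i j k) = ρ (F v u i k j) := by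
  induction hn : u + v generalizing u v with
  | zero =>
    intro X _ _ ρ i j k _
    obtain ⟨rfl, rfl⟩ : u = 0 ∧ v = 0 := by lia
    rw [hF.zero_zero]
  | succ n ih =>
    intro X _ _ ρ i j k h
    rcases u with _ | u
    · obtain rfl : v = n + 1 := by lia
      rw [← (hF.map_proj_cox ρ h.swap.rot.rot n 0).1, ih (by lia) ρ.cox h.swap.rot.rot,
        ← (hF.map_proj_cox ρ h.rot 0 n).2]
    · rw [← (hF.map_proj_cox ρ h.swap.rot v u).2, ih (by lia) ρ.cox h.swap.rot,
        ← (hF.map_proj_cox ρ h.rot.rot u v).1]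

theorem map_proj_cox_cyclic (hF : IsStepFamily K F) {X : Type u} [AddCommGroup X] [Module K X]
    (ρ : LinRep K X) {i j k : Fin 3} (h : Distinct i j k) (u v : ℕ) :
    (ρ.cox (F u v i j k)).map (ρ.proj j) = ρ (F (u + 1) v j k i) ∧
      (ρ.cox (F u v i j k)).map (ρ.proj k) = ρ (F u (v + 1) k i j) := by
  rw [(hF.map_proj_cox ρ h u v).1, (hF.map_proj_cox ρ h u v).2]
  exact ⟨hF.apply_symm ρ h.swap.rot.rot, hF.apply_symm ρ h.swap.rot⟩

end IsStepFamily

end D222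

/-! ## The rows of the table -/

namespace D222

/-- The numbers `(u, v)` of successor and predecessor steps, for the cyclic order
`i₁ → i₂ → i₃ → i₁` and with `eForm` in mind, of the word of a row of the table. -/
def rowSteps (p k : ℕ) : ℕ → ℕ × ℕ
  | 1 => (2 * (k + 3 * p), 2 * (k - 1) + 1)
  | 2 => (2 * (k + 3 * p) + 1, 2 * (k - 1) + 1)
  | 3 => (2 * (k + 3 * p + 1), 2 * (k - 1) + 1)
  | 4 => (2 * (k + 3 * p + 1) + 1, 2 * (k - 1) + 1)
  | 5 => (2 * (k + 3 * p + 2), 2 * (k - 1) + 1)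
  | 6 => (2 * (k + 3 * p + 2) + 1, 2 * (k - 1) + 1)
  | 7 => (2 * k, 2 * k)
  | 8 => (2 * k + 1, 2 * k + 1)
  | 9 => (2 * (k + 3 * p) + 1, 2 * k)
  | 10 => (2 * (k + 3 * p + 1), 2 * k)
  | 11 => (2 * (k + 3 * p + 1) + 1, 2 * k)
  | 12 => (2 * (k + 3 * p + 2), 2 * k)
  | 13 => (2 * (k + 3 * p + 2) + 1, 2 * k)
  | _ => (2 * (k + 3 * p + 3), 2 * k)

/-- The total rotation of `u` successor and `v` predecessor steps. -/
def rotation (u v : ℕ) : Fin 3 := Fin.ofNat 3 (u + 2 * v)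

theorem rotation_eq {u v : ℕ} {r : Fin 3} (h : (u + 2 * v) % 3 = r) : rotation u v = r :=
  Fin.ext h

theorem rotation_swap (u v : ℕ) : rotation v u = -rotation u v := by
  have h : ∀ a b : Fin 3, (a.1 + b.1) % 3 = 0 → a = -b := by decide
  refine h _ _ ?_
  simp only [rotation, Fin.ofNat]
  lia

/-- The member of a family `F`, indexed as `eForm`, that belongs to the word with last letter `τ 0`
and `u` successor and `v` predecessor steps for the cyclic order `τ 0 → τ 1 → τ 2 → τ 0`. -/
def oriented (F : ℕ → ℕ → Fin 3 → Fin 3 → Fin 3 → D222) (τ : Fin 3 → Fin 3) (u v : ℕ) : D222 :=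
  F u v (τ (rotation u v)) (τ (rotation u v + 1)) (τ (rotation u v + 2))

section

variable {F : ℕ → ℕ → Fin 3 → Fin 3 → Fin 3 → D222} {τ : Fin 3 → Fin 3} {u v p k line : ℕ}

theorem oriented_eq {r : Fin 3} (h : rotation u v = r) :
    oriented F τ u v = F u v (τ r) (τ (r + 1)) (τ (r + 2)) := by
  rw [oriented, h]

theorem oriented_comp_neg_eq {r : Fin 3} (h : rotation u v = r) :
    oriented F (fun s => τ (-s)) v u = F v u (τ r) (τ (r + 2)) (τ (r + 1)) := by
  have hneg : ∀ r : Fin 3, -(-r + 1) = r + 2 ∧ -(-r + 2) = r + 1 := by decide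
  rw [oriented, rotation_swap, h, neg_neg, (hneg r).1, (hneg r).2]

theorem rotation_rowSteps (hk : line ≤ 6 → 0 < k) (h₁ : 1 ≤ line) (h₂ : line ≤ 14) :
    rotation (rowSteps p k line).1 (rowSteps p k line).2 =
      Fin.ofNat 3 (if line ≤ 6 then line else if line ≤ 8 then 0 else line + 1) := by
  refine rotation_eq ?_
  interval_cases line <;>
    simp only [rowSteps, Fin.ofNat, Nat.reduceLeDiff, if_true, if_false] <;> lia

theorem admRow_eq_oriented (h : line ∈ [1, 3, 5, 9, 11, 13]) (hk : line ≤ 6 → 0 < k) :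
    (admRow (τ 0) (τ 1) (τ 2) p k line).f =
        oriented fForm τ (rowSteps p k line).1 (rowSteps p k line).2 ∧
      (admRow (τ 0) (τ 1) (τ 2) p k line).e =
        oriented eForm τ (rowSteps p k line).1 (rowSteps p k line).2 := by
  simp only [List.mem_cons, List.not_mem_nil, or_false] at h
  have hr := rotation_rowSteps (p := p) hk (by lia) (by lia)
  rw [oriented_eq hr, oriented_eq hr]
  clear hr
  rcases h with rfl | rfl | rfl | rfl | rfl | rfl <;>
    simp only [admRow, rowSteps, Nat.reduceLeDiff, if_true, if_false, Nat.reduceAdd, Fin.reduceAdd,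
      Fin.reduceOfNat, Fin.isValue, fForm_even_odd, eForm_even_odd, fForm_odd_even, eForm_odd_even,
      add_assoc, true_and]
  case inr.inr.inr.inl | inr.inr.inr.inr.inl | inr.inr.inr.inr.inr => ac_rfl
  all_goals
    rw [Nat.sub_add_cancel (hk (by norm_num))]
    constructor <;> ac_rfl

theorem admRow_eq_oriented_comp_neg (h : line ∈ [2, 4, 6, 7, 8, 10, 12, 14])
    (hk : line ≤ 6 → 0 < k) :
    (admRow (τ 0) (τ 1) (τ 2) p k line).f =
        oriented fForm (fun s => τ (-s)) (rowSteps p k line).2 (rowSteps p k line).1 ∧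
      (admRow (τ 0) (τ 1) (τ 2) p k line).e =
        oriented eForm (fun s => τ (-s)) (rowSteps p k line).2 (rowSteps p k line).1 := by
  simp only [List.mem_cons, List.not_mem_nil, or_false] at h
  have hr := rotation_rowSteps (p := p) hk (by lia) (by lia)
  rw [oriented_comp_neg_eq hr, oriented_comp_neg_eq hr]
  clear hr
  rcases h with rfl | rfl | rfl | rfl | rfl | rfl | rfl | rfl <;>
    simp only [admRow, rowSteps, Nat.reduceLeDiff, if_true, if_false, Nat.reduceAdd, Fin.reduceAdd,
      Fin.reduceOfNat, Fin.isValue, fForm_odd_odd, eForm_odd_odd, fForm_even_even, eForm_even_even,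
      add_assoc, true_and]
  case inl | inr.inl | inr.inr.inl =>
    rw [Nat.sub_add_cancel (hk (by norm_num))]
    constructor <;> ac_rfl
  case inr.inr.inr.inr.inl => constructor <;> ac_rfl
  all_goals ac_rfl

theorem admRow_word {i₁ i₂ i₃ : Fin 3} (h₁ : 1 ≤ line) (h₂ : line ≤ 14) (hk : line ≤ 6 → 0 < k) :
    (admRow i₁ i₂ i₃ p k line).word.length = (rowSteps p k line).1 + (rowSteps p k line).2 + 1 ∧
      (admRow i₁ i₂ i₃ p k line).word.getLast? = some i₁ := by
  have hlast (l : List (Fin 3)) {m : ℕ} (hm : 0 < m) :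
      (l ++ wordPow [i₂, i₁] m).getLast? = some i₁ := by
    obtain ⟨m, rfl⟩ := Nat.exists_eq_succ_of_ne_zero hm.ne'
    rw [wordPow_succ, ← List.append_assoc, List.getLast?_append]
    rfl
  constructor
  · interval_cases line <;> simp only [admRow, rowSteps, List.length_append, wordPow_length,
      List.length_cons, List.length_nil] <;> lia
  · by_cases h : line = 7 ∧ k = 0
    · rw [h.1, h.2]
      rfl
    · interval_cases line <;> simp only [admRow, ← List.append_assoc] <;> exact hlast _ (by lia)

theorem exists_rowSteps_eq (h : v ≤ u) :
    ∃ p k line : ℕ, 1 ≤ line ∧ line ≤ 14 ∧ (line ≤ 6 → 0 < k) ∧ p ≤ u + v + 1 ∧ k ≤ u + v + 1 ∧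
      rowSteps p k line = (u, v) := by
  rcases h.eq_or_lt with rfl | h
  · rcases Nat.even_or_odd' v with ⟨k, rfl | rfl⟩
    · exact ⟨0, k, 7, by lia, by lia, by lia, by lia, by lia, rfl⟩
    · exact ⟨0, k, 8, by lia, by lia, by lia, by lia, by lia, rfl⟩
  · obtain ⟨d, rfl⟩ : ∃ d, u = v + 1 + d := ⟨u - (v + 1), by lia⟩
    obtain ⟨p, r, hr, rfl⟩ : ∃ p r, r < 6 ∧ d = 6 * p + r :=
      ⟨d / 6, d % 6, Nat.mod_lt _ (by norm_num), (Nat.div_add_mod d 6).symm⟩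
    rcases Nat.even_or_odd' v with ⟨k, rfl | rfl⟩
    · refine ⟨p, k, 9 + r, by lia, by lia, by lia, by lia, by lia, ?_⟩
      interval_cases r <;> simp only [rowSteps, Prod.mk.injEq, Nat.reduceAdd, and_true] <;> lia
    · refine ⟨p, k + 1, 1 + r, by lia, by lia, by lia, by lia, by lia, ?_⟩
      interval_cases r <;> simp only [rowSteps, Prod.mk.injEq, Nat.reduceAdd] <;> lia

end

theorem Distinct.map {i j k : Fin 3} (h : Distinct i j k) (σ : Equiv.Perm (Fin 3)) :
    Distinct (σ i) (σ j) (σ k) :=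
  ⟨σ.injective.ne h.ij, σ.injective.ne h.jk, σ.injective.ne h.ik⟩

theorem perm_eq_add_or_sub : ∀ σ : Equiv.Perm (Fin 3),
    (⇑σ = fun s => σ 0 + s) ∨ ⇑σ = fun s => σ 0 - s := by
  decide

/-- The member of a family `F`, indexed as `eForm`, that belongs to the word with last letter `t`
and `u` successor and `v` predecessor steps for the cyclic order `0 → 1 → 2 → 0`. -/
def standard (F : ℕ → ℕ → Fin 3 → Fin 3 → Fin 3 → D222) (t : Fin 3) (u v : ℕ) : D222 :=
  oriented F (fun s => t + s) u v

/-! ## Cumulative elements and the Coxeter functor -/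

theorem sup'_eq_iSup_of_forall_exists {α β L : Type*} [CompleteLattice L] {A : Finset α}
    (hA : A.Nonempty) {B : Finset β} {f : α → L} {g : β → L} (h : ∀ a ∈ A, ∃ b ∈ B, f a = g b)
    (h' : ∀ b ∈ B, ∃ a ∈ A, f a = g b) : A.sup' hA f = ⨆ b ∈ B, g b := by
  refine le_antisymm (Finset.sup'_le _ _ fun a ha => ?_) (iSup₂_le fun b hb => ?_)
  · obtain ⟨b, hb, hab⟩ := h a ha
    exact hab.le.trans (le_iSup₂ (f := fun b _ => g b) b hb)
  · obtain ⟨a, ha, hab⟩ := h' b hb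
    exact hab.ge.trans (Finset.le_sup' f ha)

section

open Finset.HasAntidiagonal (antidiagonal mem_antidiagonal)

variable {K : Type u} [Field K] {X : Type u} [AddCommGroup X] [Module K X]
  {F : ℕ → ℕ → Fin 3 → Fin 3 → Fin 3 → D222}

namespace IsStepFamily

theorem apply_oriented_comp_neg (hF : IsStepFamily K F) (ρ : LinRep K X) (σ : Equiv.Perm (Fin 3))
    (u v : ℕ) : ρ (oriented F (fun s => σ (-s)) v u) = ρ (oriented F σ u v) := by
  rw [oriented_comp_neg_eq rfl, oriented_eq rfl]
  exact hF.apply_symm ρ ((Distinct.add_one_add_two _).swap.map σ)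

theorem apply_oriented_sub (hF : IsStepFamily K F) (ρ : LinRep K X) (t : Fin 3) (u v : ℕ) :
    ρ (oriented F (fun s => t - s) u v) = ρ (standard F t v u) := by
  simp only [sub_eq_add_neg]
  exact hF.apply_oriented_comp_neg ρ (Equiv.addLeft t) v u

end IsStepFamily

namespace LinRep

variable (ρ : LinRep K X) {t : Fin 3} {n : ℕ}

theorem apply_admRow (σ : Equiv.Perm (Fin 3)) {p k line : ℕ} (h₁ : 1 ≤ line) (h₂ : line ≤ 14)
    (hk : line ≤ 6 → 0 < k) :
    ρ (admRow (σ 0) (σ 1) (σ 2) p k line).f =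
        ρ (oriented fForm σ (rowSteps p k line).1 (rowSteps p k line).2) ∧
      ρ (admRow (σ 0) (σ 1) (σ 2) p k line).e =
        ρ (oriented eForm σ (rowSteps p k line).1 (rowSteps p k line).2) := by
  by_cases h : line ∈ [1, 3, 5, 9, 11, 13]
  · obtain ⟨hf, he⟩ := admRow_eq_oriented (τ := σ) (p := p) h hk
    rw [hf, he]
    exact ⟨rfl, rfl⟩
  · have h' : line ∈ [2, 4, 6, 7, 8, 10, 12, 14] := by
      clear hk
      interval_cases line <;> simp at h ⊢
    obtain ⟨hf, he⟩ := admRow_eq_oriented_comp_neg (τ := σ) (p := p) h' hk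
    rw [hf, he]
    exact ⟨IsStepFamily.fForm.apply_oriented_comp_neg ρ σ _ _,
      IsStepFamily.eForm.apply_oriented_comp_neg ρ σ _ _⟩

theorem exists_standard_eq_of_mem_admIndices {s : AdmIndex} (hs : s ∈ admIndices t (n + 1)) :
    ∃ m ∈ antidiagonal n, ρ (rowOf s).f = ρ (standard fForm t m.1 m.2) ∧
      ρ (rowOf s).e = ρ (standard eForm t m.1 m.2) := by
  obtain ⟨σ, p, k, line⟩ := s
  obtain ⟨⟨-, -, h₁, h₂⟩, hk, hlength, hlast⟩ := mem_admIndices.1 hs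
  obtain ⟨hlength', hlast'⟩ := admRow_word (i₁ := σ 0) (i₂ := σ 1) (i₃ := σ 2) (p := p) h₁ h₂ hk
  obtain ⟨hf, he⟩ := ρ.apply_admRow σ (p := p) h₁ h₂ hk
  have ht : σ 0 = t := Option.some_injective _ (hlast'.symm.trans hlast)
  have hn : (rowSteps p k line).1 + (rowSteps p k line).2 = n := by lia
  rw [rowOf, hf, he]
  rcases perm_eq_add_or_sub σ with hσ | hσ <;> rw [hσ, ht]
  · exact ⟨rowSteps p k line, mem_antidiagonal.2 hn, rfl, rfl⟩
  · exact ⟨(rowSteps p k line).swap, mem_antidiagonal.2 ((add_comm _ _).trans hn),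
      IsStepFamily.fForm.apply_oriented_sub ρ t _ _, IsStepFamily.eForm.apply_oriented_sub ρ t _ _⟩

theorem exists_mem_admIndices_eq_standard {m : ℕ × ℕ} (hm : m ∈ antidiagonal n) :
    ∃ s ∈ admIndices t (n + 1), ρ (rowOf s).f = ρ (standard fForm t m.1 m.2) ∧
      ρ (rowOf s).e = ρ (standard eForm t m.1 m.2) := by
  have hrow (σ : Equiv.Perm (Fin 3)) (hσ : σ 0 = t) {u v : ℕ} (h : v ≤ u) (huv : u + v = n) :
      ∃ s ∈ admIndices t (n + 1), ρ (rowOf s).f = ρ (oriented fForm σ u v) ∧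
        ρ (rowOf s).e = ρ (oriented eForm σ u v) := by
    obtain ⟨p, k, line, h₁, h₂, hk, hp, hk', hr⟩ := exists_rowSteps_eq h
    obtain ⟨hlength, hlast⟩ := admRow_word (i₁ := σ 0) (i₂ := σ 1) (i₃ := σ 2) (p := p) h₁ h₂ hk
    obtain ⟨hf, he⟩ := ρ.apply_admRow σ (p := p) h₁ h₂ hk
    rw [hr] at hlength hf he
    exact ⟨(σ, p, k, line), mem_admIndices.2 ⟨⟨by lia, by lia, h₁, h₂⟩, hk, by rw [hlength, huv],
      by rw [hlast, hσ]⟩, hf, he⟩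
  obtain ⟨u, v⟩ := m
  rw [mem_antidiagonal] at hm
  rcases le_total v u with h | h
  · exact hrow (Equiv.addLeft t) (add_zero t) h hm
  · obtain ⟨s, hs, hf, he⟩ := hrow (Equiv.subLeft t) (sub_zero t) h ((add_comm v u).trans hm)
    exact ⟨s, hs, hf.trans (IsStepFamily.fForm.apply_oriented_sub ρ t v u),
      he.trans (IsStepFamily.eForm.apply_oriented_sub ρ t v u)⟩

theorem apply_xCum (t : Fin 3) (n : ℕ) :
    ρ (xCum t (n + 1)) = ⨆ m ∈ antidiagonal n, ρ (standard fForm t m.1 m.2) := by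
  rw [xCum, dif_pos n.succ_pos, map_finset_sup']
  refine sup'_eq_iSup_of_forall_exists _ (fun s hs => ?_) fun m hm => ?_
  · obtain ⟨m, hm, hf, -⟩ := ρ.exists_standard_eq_of_mem_admIndices hs
    exact ⟨m, hm, hf⟩
  · obtain ⟨s, hs, hf, -⟩ := ρ.exists_mem_admIndices_eq_standard hm
    exact ⟨s, hs, hf⟩

theorem apply_yCum (t : Fin 3) (n : ℕ) :
    ρ (yCum t (n + 1)) = ⨆ m ∈ antidiagonal n, ρ (standard eForm t m.1 m.2) := by
  rw [yCum, dif_pos n.succ_pos, map_finset_sup']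
  refine sup'_eq_iSup_of_forall_exists _ (fun s hs => ?_) fun m hm => ?_
  · obtain ⟨m, hm, -, he⟩ := ρ.exists_standard_eq_of_mem_admIndices hs
    exact ⟨m, hm, he⟩
  · obtain ⟨s, hs, -, he⟩ := ρ.exists_mem_admIndices_eq_standard hm
    exact ⟨s, hs, he⟩

/-- The sum of the images of a subspace of `Φ⁺X` under the projections to `X`. For the elements of
the lattice which are of interest here, it carries the value in `Φ⁺ρ` of the element with index `n`
to the value in `ρ` of the element with index `n + 1`. -/
def push (W : Submodule K ρ.coxSpace) : Submodule K X := ⨆ s, W.map (ρ.proj s)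

theorem push_sup (V W : Submodule K ρ.coxSpace) : ρ.push (V ⊔ W) = ρ.push V ⊔ ρ.push W := by
  simp only [push, Submodule.map_sup, iSup_sup_eq]

theorem push_iSup {ι : Sort*} (W : ι → Submodule K ρ.coxSpace) :
    ρ.push (⨆ m, W m) = ⨆ m, ρ.push (W m) := by
  simp only [push, Submodule.map_iSup]
  exact iSup_comm

theorem push_bot : ρ.push ⊥ = ⊥ := by
  simp only [push, Submodule.map_bot, iSup_bot]

theorem push_eq_map_sup_map {i j k : Fin 3} (h : Distinct i j k) (W : Submodule K ρ.coxSpace) :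
    ρ.push W = W.map (ρ.proj j) ⊔ W.map (ρ.proj k) := by
  refine le_antisymm (iSup_le (h.forall_iff.2 ⟨?_, le_sup_left, le_sup_right⟩))
    (sup_le (le_iSup (fun s => W.map (ρ.proj s)) j) (le_iSup (fun s => W.map (ρ.proj s)) k))
  rintro _ ⟨η, hη, rfl⟩
  have hsum : ρ.proj i η = -(ρ.proj j η + ρ.proj k η) := by
    rw [eq_neg_iff_add_eq_zero, ← add_assoc, ← h.sum_eq fun s => ρ.proj s η, sum_proj]
  rw [hsum]
  exact neg_mem (Submodule.add_mem_sup ⟨η, hη, rfl⟩ ⟨η, hη, rfl⟩)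

variable {ρ} in
theorem Spanning.push_top (hs : ρ.Spanning) : ρ.push ⊤ = ⊤ := by
  have h := Distinct.add_one_add_two 0
  rw [ρ.push_eq_map_sup_map h, Submodule.map_top, Submodule.map_top, hs.range_proj, hs.range_proj]
  exact (hs h.jk).eq_top

end LinRep

theorem rotation_succ_left (u v : ℕ) : rotation (u + 1) v = rotation u v + 1 := by
  apply Fin.ext
  simp only [rotation, Fin.val_add, Fin.ofNat_eq_cast, Fin.val_natCast, Fin.val_one]
  lia

theorem rotation_succ_right (u v : ℕ) : rotation u (v + 1) = rotation u v + 2 := by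
  apply Fin.ext
  simp only [rotation, Fin.val_add, Fin.ofNat_eq_cast, Fin.val_natCast, Fin.val_two]
  lia

namespace IsStepFamily

theorem push_cox_standard (hF : IsStepFamily K F) (ρ : LinRep K X) (t : Fin 3) (u v : ℕ) :
    ρ.push (ρ.cox (standard F t u v)) =
      ρ (standard F t (u + 1) v) ⊔ ρ (standard F t u (v + 1)) := by
  have h : Distinct (t + rotation u v) (t + (rotation u v + 1)) (t + (rotation u v + 2)) :=
    (Distinct.add_one_add_two (rotation u v)).map (Equiv.addLeft t)
  have h₁₁ (r : Fin 3) : r + 1 + 1 = r + 2 := by lia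
  have h₁₂ (r : Fin 3) : r + 1 + 2 = r := by lia
  have h₂₁ (r : Fin 3) : r + 2 + 1 = r := by lia
  have h₂₂ (r : Fin 3) : r + 2 + 2 = r + 1 := by lia
  simp only [standard, oriented, rotation_succ_left, rotation_succ_right, h₁₁, h₁₂, h₂₁, h₂₂]
  rw [ρ.push_eq_map_sup_map h, (hF.map_proj_cox_cyclic ρ h u v).1,
    (hF.map_proj_cox_cyclic ρ h u v).2]

theorem push_iSup_cox_standard (hF : IsStepFamily K F) (ρ : LinRep K X) (t : Fin 3) (n : ℕ) :
    ρ.push (⨆ m ∈ antidiagonal n, ρ.cox (standard F t m.1 m.2)) =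
      ⨆ m ∈ antidiagonal (n + 1), ρ (standard F t m.1 m.2) := by
  simp only [LinRep.push_iSup, hF.push_cox_standard]
  refine le_antisymm (iSup₂_le fun m hm => sup_le ?_ ?_) (iSup₂_le fun m hm => ?_)
  · exact le_iSup₂_of_le (m.1 + 1, m.2) (by rw [mem_antidiagonal] at hm ⊢; lia) le_rfl
  · exact le_iSup₂_of_le (m.1, m.2 + 1) (by rw [mem_antidiagonal] at hm ⊢; lia) le_rfl
  · obtain ⟨_ | u, v⟩ := m <;> rw [mem_antidiagonal] at hm
    · obtain rfl : v = n + 1 := by lia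
      exact le_iSup₂_of_le (0, n) (mem_antidiagonal.2 (zero_add n)) le_sup_right
    · exact le_iSup₂_of_le (u, v) (mem_antidiagonal.2 (by lia)) le_sup_left

end IsStepFamily

namespace LinRep

variable (ρ : LinRep K X) (t : Fin 3) (n : ℕ)

theorem push_cox_xCum : ρ.push (ρ.cox (xCum t (n + 1))) = ρ (xCum t (n + 2)) := by
  rw [apply_xCum, apply_xCum]
  exact IsStepFamily.fForm.push_iSup_cox_standard ρ t n

theorem push_cox_yCum : ρ.push (ρ.cox (yCum t (n + 1))) = ρ (yCum t (n + 2)) := by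
  rw [apply_yCum, apply_yCum]
  exact IsStepFamily.eForm.push_iSup_cox_standard ρ t n

theorem apply_xCum_one : ρ (xCum t 1) = ρ (x t) := by
  rw [apply_xCum]
  simp [standard, oriented, fForm_zero, rotation]

theorem apply_yCum_one : ρ (yCum t 1) = ρ (y t) := by
  rw [apply_yCum]
  simp [standard, oriented, eForm_zero, rotation]

end LinRep

end

end D222

/-! ## Perfect elements in indecomposable representations -/

namespace D222

theorem aGen_le_bGen (i : Fin 3) (n : ℕ) : aGen i n ≤ bGen i n := by
  cases n with
  | zero => simp only [aGen, bGen, sup_assoc]; exact le_sup_right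
  | succ n => exact le_sup_left

variable {K : Type u} [Field K] {X : Type u} [AddCommGroup X] [Module K X] {ρ : LinRep K X}

namespace LinRep

theorem Spanning.x_le_yCum_two (hs : ρ.Spanning) (t : Fin 3) : ρ (x t) ≤ ρ (yCum t 2) := by
  rw [← push_cox_yCum, apply_yCum_one, cox_y]
  exact (hs.map_proj (ρ.x_le_y t)).ge.trans
    (le_iSup (fun s => ((ρ (x t)).comap (ρ.proj t)).map (ρ.proj s)) t)

theorem Spanning.apply_aGen_succ (hs : ρ.Spanning) (i : Fin 3) (n : ℕ) :
    ρ (aGen i (n + 1)) = ρ.push (ρ.cox (aGen i n)) := by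
  cases n with
  | zero =>
    have h : ρ (xCum (i + 1) 1) ⊔ ρ (xCum (i + 2) 1) ≤
        ρ (yCum (i + 1) 2) ⊔ ρ (yCum (i + 2) 2) := by
      rw [apply_xCum_one, apply_xCum_one]
      exact sup_le_sup (hs.x_le_yCum_two _) (hs.x_le_yCum_two _)
    simp only [aGen, map_sup, push_sup, ← apply_yCum_one, push_cox_yCum]
    rw [sup_assoc, sup_eq_right.2 h]
  | succ n => simp only [aGen, map_sup, push_sup, push_cox_xCum, push_cox_yCum]

theorem Spanning.apply_bGen_succ (hs : ρ.Spanning) (i : Fin 3) (n : ℕ) :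
    ρ (bGen i (n + 1)) = ρ.push (ρ.cox (bGen i n)) := by
  rw [bGen, map_sup, hs.apply_aGen_succ, ← push_cox_xCum, ← push_sup]
  cases n with
  | zero => rw [apply_xCum_one, ← map_sup, aGen, bGen, sup_comm, sup_assoc]
  | succ n => rw [bGen, map_sup]

theorem Spanning.apply_cGen_succ (hs : ρ.Spanning) (i : Fin 3) (n : ℕ) :
    ρ (cGen i (n + 1)) = ρ.push (ρ.cox (cGen i n)) := by
  rw [cGen, map_sup, hs.apply_aGen_succ, ← push_cox_yCum, ← push_sup]
  cases n with
  | zero =>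
    rw [apply_yCum_one, ← map_sup, cGen, aGen]
    congr 2
    fin_cases i
    · change y 1 ⊔ y 2 ⊔ y 0 = _
      ac_rfl
    · change y 2 ⊔ y 0 ⊔ y 1 = _
      ac_rfl
    · rfl
  | succ n => rw [cGen, map_sup]

end LinRep

/-- The types of indecomposable representations that are distinguished by the elements of the cubes
`U_n` and `V_{n+1}`. -/
inductive PerfectType
  | null
  | full
  | arm (i : Fin 3)
  | center

/-- The values in `ρ` of the generators of `H⁺(n)` and `H⁺(n + 1)` that occur in the cubes `U_n` and
`V_{n+1}` are those which belong to the type. -/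
inductive HasPerfectType (ρ : LinRep K X) (n : ℕ) : PerfectType → Prop
  | null (i : Fin 3) (hb : ρ (bGen i n) = ⊥) (hc : ∀ j, ρ (cGen j (n + 1)) = ⊥) :
      HasPerfectType ρ n .null
  | full (ha : ∀ j, ρ (aGen j n) = ⊤) (hc : ∀ j, ρ (cGen j (n + 1)) = ⊤) :
      HasPerfectType ρ n .full
  | arm (i : Fin 3) (ha : ∀ j, ρ (aGen j n) = if j = i then ⊥ else ⊤) (hb : ∀ j, ρ (bGen j n) = ⊤)
      (hc : ∀ j, ρ (cGen j (n + 1)) = if j = i then ⊥ else ⊤) : HasPerfectType ρ n (.arm i)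
  | center (ha : ∀ j, ρ (aGen j n) = ⊤) (hc : ∀ j, ρ (cGen j (n + 1)) = ⊥) :
      HasPerfectType ρ n .center

namespace HasPerfectType

variable {X' : Type u} [AddCommGroup X'] [Module K X'] {ρ' : LinRep K X'} {n : ℕ} {τ : PerfectType}

theorem of_comp {n' : ℕ} (h : HasPerfectType ρ n τ) (G : Submodule K X → Submodule K X')
    (hbot : G ⊥ = ⊥) (htop : G ⊤ = ⊤) (ha : ∀ j, ρ' (aGen j n') = G (ρ (aGen j n)))
    (hb : ∀ j, ρ' (bGen j n') = G (ρ (bGen j n)))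
    (hc : ∀ j, ρ' (cGen j (n' + 1)) = G (ρ (cGen j (n + 1)))) : HasPerfectType ρ' n' τ := by
  cases h with
  | null i hb' hc' => exact .null i (by rw [hb, hb', hbot]) fun j => by rw [hc, hc', hbot]
  | full ha' hc' => exact .full (fun j => by rw [ha, ha', htop]) fun j => by rw [hc, hc', htop]
  | arm i ha' hb' hc' =>
    exact .arm i (fun j => by rw [ha, ha', apply_ite G, hbot, htop])
      (fun j => by rw [hb, hb', htop]) fun j => by rw [hc, hc', apply_ite G, hbot, htop]
  | center ha' hc' => exact .center (fun j => by rw [ha, ha', htop]) fun j => by rw [hc, hc', hbot]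

theorem of_cox (hs : ρ.Spanning) (h : HasPerfectType ρ.cox n τ) : HasPerfectType ρ (n + 1) τ :=
  h.of_comp ρ.push ρ.push_bot hs.push_top (hs.apply_aGen_succ · n) (hs.apply_bGen_succ · n)
    (hs.apply_cGen_succ · (n + 1))

theorem of_iso (e : LinRep.Iso ρ ρ') (h : HasPerfectType ρ n τ) : HasPerfectType ρ' n τ :=
  h.of_comp (Submodule.map (e.toLinearEquiv : X →ₗ[K] X')) (Submodule.map_bot _)
    ((Submodule.map_top _).trans e.toLinearEquiv.range) (fun _ => (e.map_apply _).symm)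
    (fun _ => (e.map_apply _).symm) fun _ => (e.map_apply _).symm

end HasPerfectType

namespace LinRep

theorem Spanning.apply_aGen_zero (hs : ρ.Spanning) (j : Fin 3) : ρ (aGen j 0) = ⊤ := by
  rw [aGen, map_sup]
  exact (hs (Distinct.add_one_add_two j).jk).eq_top

theorem Spanning.hasPerfectType_full_zero (hs : ρ.Spanning)
    (h : ρ.cox (y 0 ⊔ y 1 ⊔ y 2) = ⊤) : HasPerfectType ρ 0 .full :=
  .full hs.apply_aGen_zero fun _ => by rw [hs.apply_cGen_succ, cGen, h, hs.push_top]

theorem Spanning.hasPerfectType_center_zero (hs : ρ.Spanning)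
    (h : ρ.cox (y 0 ⊔ y 1 ⊔ y 2) = ⊥) : HasPerfectType ρ 0 .center :=
  .center hs.apply_aGen_zero fun _ => by rw [hs.apply_cGen_succ, cGen, h, push_bot]

theorem apply_xCum_add_two [Subsingleton ρ.coxSpace] (t : Fin 3) (n : ℕ) :
    ρ (xCum t (n + 2)) = ⊥ := by
  rw [← push_cox_xCum, Subsingleton.elim (ρ.cox _) ⊥, push_bot]

theorem apply_yCum_add_two [Subsingleton ρ.coxSpace] (t : Fin 3) (n : ℕ) :
    ρ (yCum t (n + 2)) = ⊥ := by
  rw [← push_cox_yCum, Subsingleton.elim (ρ.cox _) ⊥, push_bot]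

theorem apply_aGen_one [Subsingleton ρ.coxSpace] (j : Fin 3) :
    ρ (aGen j 1) = ρ (x (j + 1)) ⊔ ρ (x (j + 2)) := by
  simp only [aGen, map_sup, apply_yCum_add_two, apply_xCum_one, zero_add, sup_bot_eq]

theorem apply_cGen_one [Subsingleton ρ.coxSpace] (j : Fin 3) :
    ρ (cGen j 1) = ρ (x (j + 1)) ⊔ ρ (x (j + 2)) := by
  rw [cGen, map_sup, apply_aGen_one, apply_yCum_add_two, sup_bot_eq]

theorem apply_cGen_add_two [Subsingleton ρ.coxSpace] (j : Fin 3) (n : ℕ) :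
    ρ (cGen j (n + 2)) = ⊥ := by
  simp only [cGen, aGen, map_sup, apply_xCum_add_two, apply_yCum_add_two, sup_bot_eq]

variable {i : Fin 3}

theorem subsingleton_coxSpace (hy : ∀ s ≠ i, ρ (y s) = ⊥) : Subsingleton ρ.coxSpace := by
  have h := Distinct.add_one_add_two i
  refine subsingleton_of_forall_eq 0 fun η => ρ.coxSpace_ext ?_
  have hzero (s : Fin 3) (hs : s ≠ i) : ρ.proj s η = 0 :=
    (Submodule.mem_bot K).1 (hy s hs ▸ ρ.proj_mem s η)
  have hsum := ρ.sum_proj η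
  rw [h.sum_eq, hzero _ h.ij.symm, hzero _ h.ik.symm, add_zero, add_zero] at hsum
  exact h.forall_iff.2 ⟨hsum, hzero _ h.ij.symm, hzero _ h.ik.symm⟩

theorem apply_x_eq_bot (hy : ∀ s ≠ i, ρ (y s) = ⊥) : ∀ s ≠ i, ρ (x s) = ⊥ :=
  fun s hs => eq_bot_mono (ρ.x_le_y s) (hy s hs)

theorem hasPerfectType_null_zero (hy : ∀ s ≠ i, ρ (y s) = ⊥) (hx : ρ (x i) = ⊥) :
    HasPerfectType ρ 0 .null := by
  have := subsingleton_coxSpace hy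
  have h := Distinct.add_one_add_two i
  have hx' (s : Fin 3) : ρ (x s) = ⊥ := by
    by_cases hs : s = i
    · rw [hs, hx]
    · exact apply_x_eq_bot hy s hs
  refine .null i ?_ fun j => by rw [apply_cGen_one, hx', hx', sup_bot_eq]
  rw [bGen, map_sup, map_sup, hx, hy _ h.ij.symm, hy _ h.ik.symm, sup_bot_eq, sup_bot_eq]

theorem hasPerfectType_null_succ (hy : ∀ s ≠ i, ρ (y s) = ⊥) (n : ℕ) :
    HasPerfectType ρ (n + 1) .null := by
  have := subsingleton_coxSpace hy
  have h := Distinct.add_one_add_two i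
  refine .null i ?_ fun j => apply_cGen_add_two j n
  rw [bGen, map_sup, apply_xCum_add_two, sup_bot_eq]
  cases n with
  | zero =>
    rw [apply_aGen_one, apply_x_eq_bot hy _ h.ij.symm, apply_x_eq_bot hy _ h.ik.symm, sup_bot_eq]
  | succ n => simp only [aGen, map_sup, apply_xCum_add_two, apply_yCum_add_two, sup_bot_eq]

theorem sup_eq_ite {L : Type*} [Lattice L] [BoundedOrder L] {g : Fin 3 → L} (hi : g i = ⊤)
    (h : ∀ s ≠ i, g s = ⊥) (j : Fin 3) : g (j + 1) ⊔ g (j + 2) = if j = i then ⊥ else ⊤ := by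
  have hg : g = fun s => if s = i then ⊤ else ⊥ := by
    ext s
    split_ifs with hs
    exacts [hs ▸ hi, h s hs]
  rw [hg]
  fin_cases i <;> fin_cases j <;> simp

theorem hasPerfectType_arm_zero (hy : ∀ s ≠ i, ρ (y s) = ⊥) (hx : ρ (x i) = ⊤) :
    HasPerfectType ρ 0 (.arm i) := by
  have := subsingleton_coxSpace hy
  have ha (j : Fin 3) : ρ (aGen j 0) = if j = i then ⊥ else ⊤ := by
    rw [aGen, map_sup]
    exact sup_eq_ite (g := fun s => ρ (y s)) (top_le_iff.1 (hx ▸ ρ.x_le_y i)) hy j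
  refine .arm i ha (fun j => ?_) fun j => ?_
  · by_cases hj : j = i
    · rw [bGen, map_sup, map_sup, hj, hx, top_sup_eq, top_sup_eq]
    · exact top_unique (((ha j).trans (if_neg hj)).ge.trans (ρ.mono (aGen_le_bGen j 0)))
  · rw [apply_cGen_one]
    exact sup_eq_ite (g := fun s => ρ (x s)) hx (apply_x_eq_bot hy) j

theorem Indecomposable.exists_hasPerfectType (n : ℕ) : ∀ {X : Type u} [AddCommGroup X] [Module K X]
    {ρ : LinRep K X}, ρ.Indecomposable → ∃ τ, HasPerfectType ρ n τ := by
  induction n with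
  | zero =>
    intro X _ _ ρ hρ
    rcases hρ.spanning_or with hs | ⟨hsimple, i, hy⟩
    · rcases (hs.indecomposable_cox_iff.2 hρ).spanning_or with hs' | ⟨hsimple, -⟩
      · have h01 : (0 : Fin 3) ≠ 1 := by decide
        refine ⟨.full, hs.hasPerfectType_full_zero ?_⟩
        rw [map_sup, map_sup, (hs' h01).eq_top, top_sup_eq]
      · rcases eq_bot_or_eq_top (ρ.cox (y 0 ⊔ y 1 ⊔ y 2)) with h | h
        · exact ⟨.center, hs.hasPerfectType_center_zero h⟩
        · exact ⟨.full, hs.hasPerfectType_full_zero h⟩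
    · rcases eq_bot_or_eq_top (ρ (x i)) with hx | hx
      · exact ⟨.null, hasPerfectType_null_zero hy hx⟩
      · exact ⟨.arm i, hasPerfectType_arm_zero hy hx⟩
  | succ n ih =>
    intro X _ _ ρ hρ
    rcases hρ.spanning_or with hs | ⟨-, i, hy⟩
    · obtain ⟨τ, h⟩ := ih (hs.indecomposable_cox_iff.2 hρ)
      exact ⟨τ, h.of_cox hs⟩
    · exact ⟨.null, hasPerfectType_null_succ hy n⟩

end LinRep

end D222

/-! ## The inverse Coxeter functor -/

namespace D222

namespace LinRep

variable {K : Type u} [Field K] {X : Type u} [AddCommGroup X] [Module K X] (ρ : LinRep K X)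

/-- The space of the relations `∑ ξ_i = 0` between the three copies of `X` that generate the space
of `Φ⁻ρ`: the sum of `⨁ ρ(x_i)` and of the diagonal. -/
def relSpace : Submodule K (Fin 3 → X) :=
  Submodule.pi Set.univ (fun i => ρ (x i)) ⊔ LinearMap.range (LinearMap.pi fun _ => LinearMap.id)

variable {ρ} in
theorem mem_relSpace {ξ : Fin 3 → X} : ξ ∈ ρ.relSpace ↔ ∃ z, ∀ i, ξ i - z ∈ ρ (x i) := by
  rw [relSpace, Submodule.mem_sup']
  constructor
  · rintro ⟨⟨ζ, hζ⟩, ⟨_, z, rfl⟩, rfl⟩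
    exact ⟨z, fun i => by simpa using Submodule.mem_pi.1 hζ i trivial⟩
  · rintro ⟨z, hz⟩
    exact ⟨⟨fun i => ξ i - z, Submodule.mem_pi.2 fun i _ => hz i⟩, ⟨_, z, rfl⟩,
      funext fun i => sub_add_cancel (ξ i) z⟩

/-- The inclusion of the `i`-th copy of `X` into the space of `Φ⁻ρ`. -/
def incl (i : Fin 3) : X →ₗ[K] (Fin 3 → X) ⧸ ρ.relSpace :=
  ρ.relSpace.mkQ ∘ₗ LinearMap.single K (fun _ => X) i

/-- The representation `Φ⁻ρ`. -/
def coxInv : LinRep K ((Fin 3 → X) ⧸ ρ.relSpace) :=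
  ofChains (fun i => (ρ (y i)).map (ρ.incl i)) (fun i => LinearMap.range (ρ.incl i))
    fun _ => LinearMap.map_le_range

theorem sum_incl (ξ : Fin 3 → X) : ∑ i, ρ.incl i (ξ i) = ρ.relSpace.mkQ ξ := by
  simp only [incl, LinearMap.comp_apply, LinearMap.coe_single, ← map_sum, Finset.univ_sum_single]

theorem sum_incl_eq_zero {ξ : Fin 3 → X} :
    ∑ i, ρ.incl i (ξ i) = 0 ↔ ∃ z, ∀ i, ξ i - z ∈ ρ (x i) := by
  rw [sum_incl, Submodule.mkQ_apply, Submodule.Quotient.mk_eq_zero, mem_relSpace]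

theorem sum_incl_diag (z : X) : ∑ i, ρ.incl i z = 0 :=
  (ρ.sum_incl_eq_zero (ξ := fun _ => z)).2 ⟨z, fun i => by rw [sub_self]; exact zero_mem _⟩

theorem spanning_coxInv : ρ.coxInv.Spanning := by
  intro j k hjk
  obtain ⟨i, h⟩ := Distinct.exists_left hjk
  refine codisjoint_iff.2 (top_unique fun w _ => ?_)
  obtain ⟨ξ, rfl⟩ := Submodule.mkQ_surjective _ w
  have hdiag := ρ.sum_incl_diag (ξ i)
  rw [h.sum_eq] at hdiag
  refine Submodule.mem_sup.2 ⟨_, ⟨ξ j - ξ i, rfl⟩, _, ⟨ξ k - ξ i, rfl⟩, ?_⟩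
  rw [← sum_incl, h.sum_eq, map_sub, map_sub, ← sub_eq_zero, ← neg_eq_zero, ← hdiag]
  abel

variable {ρ}

theorem incl_eq_zero (hρ : Pairwise fun i j => Disjoint (ρ (x i)) (ρ (x j))) {i : Fin 3} {z : X} :
    ρ.incl i z = 0 ↔ z ∈ ρ (x i) := by
  have h := Distinct.add_one_add_two i
  rw [incl, LinearMap.comp_apply, Submodule.mkQ_apply, Submodule.Quotient.mk_eq_zero, mem_relSpace]
  simp only [LinearMap.coe_single, h.forall_iff, Pi.single_eq_same, Pi.single_eq_of_ne h.ij.symm,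
    Pi.single_eq_of_ne h.ik.symm, zero_sub, neg_mem_iff]
  constructor
  · rintro ⟨w, hi, hj, hk⟩
    rwa [Submodule.disjoint_def.1 (hρ h.jk) w hj hk, sub_zero] at hi
  · exact fun hz => ⟨0, by rwa [sub_zero], zero_mem _, zero_mem _⟩

variable (ρ) in
/-- The canonical map from `ρ` to `Φ⁺Φ⁻ρ`. -/
def toCoxCoxInv : X →ₗ[K] ρ.coxInv.coxSpace :=
  LinearMap.codRestrict _ (LinearMap.pi ρ.incl) fun z =>
    mem_coxSpace.2 ⟨fun _ => ⟨z, rfl⟩, ρ.sum_incl_diag z⟩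

theorem proj_toCoxCoxInv (i : Fin 3) (z : X) : ρ.coxInv.proj i (ρ.toCoxCoxInv z) = ρ.incl i z := rfl

theorem toCoxCoxInv_bijective (hρ : Pairwise fun i j => Disjoint (ρ (x i)) (ρ (x j))) :
    Function.Bijective ρ.toCoxCoxInv := by
  constructor
  · refine (injective_iff_map_eq_zero _).2 fun z hz => ?_
    have hmem (i : Fin 3) : z ∈ ρ (x i) := by
      rw [← incl_eq_zero hρ, ← proj_toCoxCoxInv, hz, map_zero]
    exact Submodule.disjoint_def.1 (hρ (Distinct.add_one_add_two 0).ij) z (hmem _) (hmem _)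
  · intro η
    have hproj (i : Fin 3) : ∃ z, ρ.incl i z = ρ.coxInv.proj i η := ρ.coxInv.proj_mem i η
    choose ξ hξ using hproj
    obtain ⟨z, hz⟩ := ρ.sum_incl_eq_zero.1
      ((Finset.sum_congr rfl fun i _ => hξ i).trans (ρ.coxInv.sum_proj η))
    refine ⟨z, ρ.coxInv.coxSpace_ext fun i => ?_⟩
    rw [proj_toCoxCoxInv, ← hξ, eq_comm, ← sub_eq_zero, ← map_sub, incl_eq_zero hρ]
    exact hz i

/-- `Φ⁺Φ⁻ρ` is isomorphic to `ρ` if the subspaces `ρ(x_i)` are pairwise disjoint. -/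
noncomputable def isoCoxCoxInv (hρ : Pairwise fun i j => Disjoint (ρ (x i)) (ρ (x j))) :
    Iso ρ ρ.coxInv.cox where
  __ := LinearEquiv.ofBijective ρ.toCoxCoxInv (toCoxCoxInv_bijective hρ)
  map_x i := by
    have hcomap : ρ (x i) = (ρ.coxInv.cox (x i)).comap ρ.toCoxCoxInv := by
      ext z
      rw [cox_x, Submodule.mem_comap, Submodule.mem_comap, Submodule.mem_bot, proj_toCoxCoxInv,
        incl_eq_zero hρ]
    rw [hcomap]
    exact Submodule.map_comap_eq_of_surjective (toCoxCoxInv_bijective hρ).surjective _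
  map_y i := by
    have hcomap : ρ (y i) = (ρ.coxInv.cox (y i)).comap ρ.toCoxCoxInv := by
      ext z
      refine ⟨fun hz => ⟨z, hz, rfl⟩, ?_⟩
      rintro ⟨w, hw, hwz⟩
      rw [proj_toCoxCoxInv, ← sub_eq_zero, ← map_sub, incl_eq_zero hρ] at hwz
      rw [← sub_sub_cancel w z]
      exact sub_mem hw (ρ.x_le_y i hwz)
    rw [hcomap]
    exact Submodule.map_comap_eq_of_surjective (toCoxCoxInv_bijective hρ).surjective _

/-! ## The defect -/

variable (ρ) in
/-- The defect of a representation. It is invariant under the Coxeter functors, and its negativity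
ensures that `Φ⁻` is defined arbitrarily often. -/
noncomputable def defect : ℤ :=
  ∑ i, ((Module.finrank K (ρ (x i)) : ℤ) + Module.finrank K (ρ (y i))) - 3 * Module.finrank K X

theorem Iso.defect_eq {X' : Type u} [AddCommGroup X'] [Module K X'] {ρ' : LinRep K X'}
    (e : Iso ρ ρ') : ρ.defect = ρ'.defect := by
  have h (a : D222) : Module.finrank K (ρ' a) = Module.finrank K (ρ a) := by
    rw [← e.map_apply]
    exact e.toLinearEquiv.finrank_map_eq _
  simp only [defect, h, e.toLinearEquiv.finrank_eq]

theorem finrank_map_add_finrank_ker {V W : Type*} [AddCommGroup V] [Module K V] [AddCommGroup W]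
    [Module K W] (f : V →ₗ[K] W) {P : Submodule K V} [FiniteDimensional K P]
    (h : LinearMap.ker f ≤ P) : Module.finrank K (P.map f) + Module.finrank K (LinearMap.ker f) =
      Module.finrank K P := by
  rw [← LinearMap.range_domRestrict, ← (Submodule.comapSubtypeEquivOfLe h).finrank_eq,
    ← LinearMap.ker_domRestrict]
  exact (f.domRestrict P).finrank_range_add_finrank_ker

namespace Spanning

variable [FiniteDimensional K X]

theorem finrank_coxSpace_add (hs : ρ.Spanning) :
    Module.finrank K ρ.coxSpace + Module.finrank K X = ∑ i, Module.finrank K (ρ (y i)) := by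
  let S := LinearMap.lsum K (fun i => ρ (y i)) K fun i => (ρ (y i)).subtype
  have hrange : LinearMap.range S = ⊤ := by
    have h (i : Fin 3) : ρ (y i) ≤ LinearMap.range S := fun z hz =>
      ⟨Pi.single i ⟨z, hz⟩, LinearMap.lsum_piSingle ..⟩
    have h01 : (0 : Fin 3) ≠ 1 := by decide
    exact top_unique ((hs h01).eq_top.ge.trans (sup_le (h 0) (h 1)))
  let e : LinearMap.ker S ≃ₗ[K] ρ.coxSpace :=
    { toFun f := ⟨fun i => f.1 i, mem_coxSpace.2 ⟨fun i => (f.1 i).2, by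
        simpa [S, LinearMap.lsum_apply] using f.2⟩⟩
      map_add' _ _ := rfl
      map_smul' _ _ := rfl
      invFun η := ⟨fun i => ⟨ρ.proj i η, ρ.proj_mem i η⟩, by
        simpa [S, LinearMap.lsum_apply] using ρ.sum_proj η⟩
      left_inv _ := rfl
      right_inv _ := rfl }
  rw [← e.finrank_eq, ← Module.finrank_pi_fintype, ← S.finrank_range_add_finrank_ker, hrange,
    finrank_top, add_comm]

theorem finrank_cox_x_add (hs : ρ.Spanning) (i : Fin 3) :
    Module.finrank K (ρ.cox (x i)) + Module.finrank K (ρ (y i)) =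
      Module.finrank K ρ.coxSpace := by
  rw [← hs.range_proj, ← (ρ.proj i).finrank_range_add_finrank_ker, add_comm]
  rfl

theorem finrank_cox_y (hs : ρ.Spanning) (i : Fin 3) :
    Module.finrank K (ρ.cox (y i)) =
      Module.finrank K (ρ (x i)) + Module.finrank K (ρ.cox (x i)) := by
  rw [← hs.map_proj (ρ.x_le_y i)]
  exact (finrank_map_add_finrank_ker (ρ.proj i) (ρ.cox.x_le_y i)).symm

theorem defect_cox (hs : ρ.Spanning) : ρ.cox.defect = ρ.defect := by
  have hX := hs.finrank_coxSpace_add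
  have hx := hs.finrank_cox_x_add
  have hy := hs.finrank_cox_y
  simp only [defect, Fin.sum_univ_three] at hX ⊢
  linarith [hx 0, hx 1, hx 2, hy 0, hy 1, hy 2]

end Spanning

theorem Indecomposable.disjoint_x (hρ : ρ.Indecomposable) (hdef : ρ.defect < 0) :
    Pairwise fun i j => Disjoint (ρ (x i)) (ρ (x j)) := by
  intro j k hjk
  obtain ⟨i, h⟩ := Distinct.exists_left hjk
  refine Submodule.disjoint_def.2 fun v hj hk => ?_
  by_contra hv
  obtain ⟨f, hf, hx, hy⟩ := exists_dual_mem_or_le_ker hv (ρ.x_le_y i)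
  have hsimple : IsSimpleModule K X := hρ.isSimpleModule hf
    (h.forall_iff.2 ⟨hx, .inl hj, .inl hk⟩)
    (h.forall_iff.2 ⟨hy, .inl (ρ.x_le_y j hj), .inl (ρ.x_le_y k hk)⟩)
  have htop {W : Submodule K X} (hW : v ∈ W) : Module.finrank K W = Module.finrank K X := by
    rw [(eq_bot_or_eq_top W).resolve_left fun hbot => hv ((Submodule.mem_bot K).1 (hbot ▸ hW)),
      finrank_top]
  rw [defect, h.sum_eq, htop hj, htop hk, htop (ρ.x_le_y j hj), htop (ρ.x_le_y k hk)] at hdef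
  lia

end LinRep

/-! ## Existence of indecomposable representations of every type -/

open LinRep

/-- There is a finite-dimensional indecomposable representation with negative defect of type `τ`. -/
def IsRealized (K : Type u) [Field K] (n : ℕ) (τ : PerfectType) : Prop :=
  ∃ (X : Type u) (_ : AddCommGroup X) (_ : Module K X) (_ : FiniteDimensional K X)
    (ρ : LinRep K X), ρ.Indecomposable ∧ ρ.defect < 0 ∧ HasPerfectType ρ n τ

section

variable {K : Type u} [Field K] {X : Type u} [AddCommGroup X] [Module K X] {ρ : LinRep K X}

theorem LinRep.Indecomposable.coxInv (hρ : ρ.Indecomposable) (hdef : ρ.defect < 0) :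
    ρ.coxInv.Indecomposable := by
  rw [← ρ.spanning_coxInv.indecomposable_cox_iff]
  exact (indecomposable_congr (isoCoxCoxInv (hρ.disjoint_x hdef)).endRingEquiv).1 hρ

theorem LinRep.Indecomposable.defect_coxInv [FiniteDimensional K X] (hρ : ρ.Indecomposable)
    (hdef : ρ.defect < 0) : ρ.coxInv.defect = ρ.defect := by
  rw [(isoCoxCoxInv (hρ.disjoint_x hdef)).defect_eq, ρ.spanning_coxInv.defect_cox]

theorem LinRep.indecomposable_of_isSimpleModule [IsSimpleModule K X] (ρ : LinRep K X) :
    ρ.Indecomposable :=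
  ⟨IsSimpleModule.nontrivial K X, fun _ V hUV _ => (eq_bot_or_eq_top V).symm.imp_left fun hV => by
    rw [hV] at hUV
    exact disjoint_top.1 hUV.disjoint⟩

theorem IsRealized.succ {n : ℕ} {τ : PerfectType} (h : IsRealized K n τ) :
    IsRealized K (n + 1) τ := by
  obtain ⟨X, _, _, _, ρ, hρ, hdef, hτ⟩ := h
  exact ⟨_, inferInstance, inferInstance, inferInstance, ρ.coxInv, hρ.coxInv hdef,
    (hρ.defect_coxInv hdef).trans_lt hdef,
    (hτ.of_iso (isoCoxCoxInv (hρ.disjoint_x hdef))).of_cox ρ.spanning_coxInv⟩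

end

variable (K : Type u) [Field K]

theorem isRealized_center_zero : IsRealized K 0 .center := by
  let ρ : LinRep K K := ofChains (fun _ => ⊥) (fun _ => ⊥) fun _ => le_rfl
  have hρ : ρ.Indecomposable := ρ.indecomposable_of_isSimpleModule
  have hx (s : Fin 3) : Module.finrank K (ρ (x s)) = 0 := finrank_bot K K
  have hy (s : Fin 3) : Module.finrank K (ρ (y s)) = 0 := finrank_bot K K
  have hdef : ρ.defect < 0 := by simp [defect, hx, hy]
  refine ⟨_, inferInstance, inferInstance, inferInstance, ρ.coxInv, hρ.coxInv hdef,
    (hρ.defect_coxInv hdef).trans_lt hdef, ρ.spanning_coxInv.hasPerfectType_center_zero ?_⟩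
  rw [← (isoCoxCoxInv (hρ.disjoint_x hdef)).map_apply]
  simp [ρ]

theorem isRealized_arm_zero (i : Fin 3) : IsRealized K 0 (.arm i) := by
  let P (s : Fin 3) : Submodule K K := if s = i then ⊤ else ⊥
  let ρ : LinRep K K := ofChains P P fun _ => le_rfl
  have hP (s : Fin 3) : Module.finrank K (P s) = if s = i then 1 else 0 := by
    by_cases hs : s = i
    · rw [show P s = ⊤ from if_pos hs, finrank_top, Module.finrank_self, if_pos hs]
    · rw [show P s = ⊥ from if_neg hs, finrank_bot, if_neg hs]
  have hx (s : Fin 3) : Module.finrank K (ρ (x s)) = if s = i then 1 else 0 := hP s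
  have hy (s : Fin 3) : Module.finrank K (ρ (y s)) = if s = i then 1 else 0 := hP s
  refine ⟨K, inferInstance, inferInstance, inferInstance, ρ, ρ.indecomposable_of_isSimpleModule, ?_,
    hasPerfectType_arm_zero (fun s hs => if_neg hs) (if_pos rfl)⟩
  simp [defect, hx, hy, Finset.sum_add_distrib]

variable {K}

theorem IsRealized.of_zero {τ : PerfectType} (h : IsRealized K 0 τ) : ∀ n, IsRealized K n τ
  | 0 => h
  | n + 1 => (h.of_zero n).succ

end D222

/-! ## The two cubes -/

/-- The embedding of a lattice as a slice of its product with another lattice. -/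
def latticeHomSlice {A B : Type*} [Lattice A] [Lattice B] (b : B) : LatticeHom A (A × B) where
  toFun a := (a, b)
  map_sup' _ _ := Prod.ext rfl (sup_idem b).symm
  map_inf' _ _ := Prod.ext rfl (inf_idem b).symm

theorem latticeHomSlice_injective {A B : Type*} [Lattice A] [Lattice B] (b : B) :
    Function.Injective (latticeHomSlice (A := A) b) :=
  fun _ _ h => congrArg Prod.fst h

theorem isBooleanSublattice_range {B L : Type*} [BooleanAlgebra B] [Lattice L]
    (f : LatticeHom B L) : IsBooleanSublattice (Set.range f) where
  supClosed := by
    rintro _ ⟨s, rfl⟩ _ ⟨t, rfl⟩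
    exact ⟨s ⊔ t, map_sup f s t⟩
  infClosed := by
    rintro _ ⟨s, rfl⟩ _ ⟨t, rfl⟩
    exact ⟨s ⊓ t, map_inf f s t⟩
  distrib := by
    rintro _ ⟨r, rfl⟩ _ ⟨s, rfl⟩ _ ⟨t, rfl⟩
    rw [← map_sup, ← map_inf, inf_sup_left, map_sup, map_inf, map_inf]
  complemented := by
    refine ⟨f ⊥, ⟨⊥, rfl⟩, f ⊤, ⟨⊤, rfl⟩, ?_, ?_⟩
    · rintro _ ⟨z, rfl⟩
      exact ⟨OrderHomClass.mono f bot_le, OrderHomClass.mono f le_top⟩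
    · rintro _ ⟨z, rfl⟩
      refine ⟨f zᶜ, ⟨zᶜ, rfl⟩, ?_, ?_⟩
      · rw [← map_inf, inf_compl_eq_bot]
      · rw [← map_sup, sup_compl_eq_top]

theorem isBooleanSublattice_range_and_ncard {B L : Type*} [BooleanAlgebra B] [Lattice L]
    {f : LatticeHom B L} (hf : Function.Injective f) :
    IsBooleanSublattice (Set.range f) ∧ (Set.range f).ncard = Nat.card B :=
  ⟨isBooleanSublattice_range f, by
    rw [← Nat.card_coe_set_eq, Nat.card_range_of_injective hf]⟩

theorem inf_univ_ite_eq {ι L : Type*} [Fintype ι] [DecidableEq ι] [SemilatticeInf L]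
    [BoundedOrder L] (s : ι → Bool) (i : ι) :
    (Finset.univ.inf fun j => if s j then (⊤ : L) else if j = i then ⊥ else ⊤) =
      if s i then ⊤ else ⊥ := by
  split_ifs with hi
  · exact (Finset.inf_eq_top_iff _ _).2 fun j _ => by grind
  · exact eq_bot_iff.2 ((Finset.inf_le (Finset.mem_univ i)).trans (by simp [hi]))

namespace D222

/-- The element of the lower cube `U_n` with index `s`. -/
def lowerElt (n : ℕ) (s : Fin 3 → Bool) : D222 :=
  Finset.univ.inf fun i => if s i then bGen i n else aGen i n

/-- The element of the upper cube `V_{n+1}` with index `s`; the greatest index stands for the sum of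
the `c_i`, as the empty intersection would give `I`. -/
def upperElt (n : ℕ) (s : Fin 3 → Bool) : D222 :=
  if ∀ i, s i then cGen 0 (n + 1) ⊔ cGen 1 (n + 1) ⊔ cGen 2 (n + 1)
  else Finset.univ.inf fun i => if s i then ⊤ else cGen i (n + 1)

/-- The elements of `U_n` and `V_{n+1}`, indexed by a Boolean algebra. -/
def cubeElt (n : ℕ) (s : (Fin 3 → Bool) × Bool) : D222 :=
  if s.2 then lowerElt n s.1 else upperElt n s.1

theorem range_lowerElt (n : ℕ) : Set.range (lowerElt n) = lowerCube n := by
  have huniv : (Set.univ : Set (Fin 3 → Bool)) =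
      {![true, true, true], ![false, true, true], ![true, false, true], ![true, true, false],
        ![false, false, true], ![false, true, false], ![true, false, false],
        ![false, false, false]} := (Set.eq_univ_of_forall (by decide)).symm
  simp only [← Set.image_univ, huniv, Set.image_insert_eq, Set.image_singleton, lowerElt,
    (Distinct.add_one_add_two 0).inf_univ_eq]
  rfl

theorem range_upperElt (n : ℕ) : Set.range (upperElt n) = upperCube (n + 1) := by
  have huniv : (Set.univ : Set (Fin 3 → Bool)) =
      {![false, true, true], ![true, false, true], ![true, true, false], ![false, false, true],
        ![true, false, false], ![false, true, false], ![false, false, false],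
        ![true, true, true]} := (Set.eq_univ_of_forall (by decide)).symm
  simp [← Set.image_univ, huniv, Set.image_insert_eq, upperElt, upperCube, Fin.forall_fin_succ,
    (Distinct.add_one_add_two 0).inf_univ_eq]

theorem range_cubeElt (n : ℕ) :
    Set.range (cubeElt n) = lowerCube n ∪ upperCube (n + 1) := by
  rw [← range_lowerElt, ← range_upperElt]
  ext d
  simp [cubeElt, exists_or, or_comm]

/-- The value of the element of the two cubes with index `s` in a representation of type `τ`:
`true` stands for the whole space and `false` for zero. -/
def cubeValue : PerfectType → (Fin 3 → Bool) × Bool → Bool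
  | .null, _ => false
  | .full, _ => true
  | .arm i, s => s.1 i
  | .center, s => s.2

theorem cubeValue_sup (τ : PerfectType) (s t : (Fin 3 → Bool) × Bool) :
    cubeValue τ (s ⊔ t) = (cubeValue τ s || cubeValue τ t) := by
  cases τ <;> rfl

theorem cubeValue_inf (τ : PerfectType) (s t : (Fin 3 → Bool) × Bool) :
    cubeValue τ (s ⊓ t) = (cubeValue τ s && cubeValue τ t) := by
  cases τ <;> rfl

section

variable {K : Type u} [Field K] {X : Type u} [AddCommGroup X] [Module K X] {ρ : LinRep K X} {n : ℕ}
  {τ : PerfectType}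

theorem LinRep.apply_inf_univ (ρ : LinRep K X) (g : Fin 3 → D222) :
    ρ (Finset.univ.inf g) = Finset.univ.inf fun i => ρ (g i) :=
  Finset.apply_inf_eq_inf_comp ρ (fun _ _ => map_inf _ _ _) ρ.apply_top

theorem HasPerfectType.apply_lowerElt (h : HasPerfectType ρ n τ) (s : Fin 3 → Bool) :
    ρ (lowerElt n s) = if cubeValue τ (s, true) then ⊤ else ⊥ := by
  have hab (j : Fin 3) : ρ (aGen j n) ≤ ρ (bGen j n) := ρ.mono (aGen_le_bGen j n)
  have hb (ha : ∀ j, ρ (aGen j n) = ⊤) (j : Fin 3) : ρ (bGen j n) = ⊤ := top_le_iff.1 (ha j ▸ hab j)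
  simp only [lowerElt, LinRep.apply_inf_univ, apply_ite ρ]
  cases h with
  | null i hb hc =>
    refine eq_bot_iff.2 ((Finset.inf_le (Finset.mem_univ i)).trans ?_)
    split_ifs
    exacts [hb.le, (hab i).trans hb.le]
  | full ha hc => simp [ha, hb ha, cubeValue]
  | arm i ha hb hc =>
    simp only [ha, hb]
    exact inf_univ_ite_eq s i
  | center ha hc => simp [ha, hb ha, cubeValue]

theorem HasPerfectType.apply_upperElt (h : HasPerfectType ρ n τ) (s : Fin 3 → Bool) :
    ρ (upperElt n s) = if cubeValue τ (s, false) then ⊤ else ⊥ := by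
  have hzero (hc : ∀ j, ρ (cGen j (n + 1)) = ⊥) : ρ (upperElt n s) = ⊥ := by
    by_cases hs : ∀ i, s i
    · simp only [upperElt, hs, implies_true, if_true, map_sup, hc, sup_idem]
    · obtain ⟨i, hi⟩ := not_forall.1 hs
      rw [upperElt, if_neg hs, LinRep.apply_inf_univ, eq_bot_iff]
      refine (Finset.inf_le (Finset.mem_univ i)).trans ?_
      rw [if_neg hi, hc]
  cases h with
  | null i hb hc => exact hzero hc
  | full ha hc =>
    simp [upperElt, apply_ite ρ, LinRep.apply_inf_univ, hc, cubeValue]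
  | arm i ha hb hc =>
    by_cases hs : ∀ i, s i
    · simp only [upperElt, hs, implies_true, if_true, map_sup, hc, cubeValue]
      fin_cases i <;> simp
    · rw [upperElt, if_neg hs, LinRep.apply_inf_univ]
      simp only [apply_ite ρ, LinRep.apply_top, hc]
      exact inf_univ_ite_eq s i
  | center ha hc => exact hzero hc

theorem HasPerfectType.apply_cubeElt (h : HasPerfectType ρ n τ) (s : (Fin 3 → Bool) × Bool) :
    ρ (cubeElt n s) = if cubeValue τ s then ⊤ else ⊥ := by
  obtain ⟨s, _ | _⟩ := s
  exacts [h.apply_upperElt s, h.apply_lowerElt s]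

end

end D222

namespace D222ModTheta

open D222

variable {K : Type u} [Field K] {n : ℕ}

theorem mk_cubeElt_eq {a : D222} {s : (Fin 3 → Bool) × Bool}
    (h : ∀ {X : Type u} [AddCommGroup X] [Module K X] {ρ : LinRep K X} {τ : PerfectType},
      HasPerfectType ρ n τ → ρ a = if cubeValue τ s then ⊤ else ⊥) :
    mk K (cubeElt n s) = mk K a := by
  refine Quotient.sound fun X _ _ _ ρ hρ => ?_
  obtain ⟨τ, hτ⟩ := hρ.exists_hasPerfectType n
  exact (hτ.apply_cubeElt s).trans (h hτ).symm

variable (K n) in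
/-- The lattice of the classes of the elements of `U_n` and `V_{n+1}`, parametrized by a Boolean
algebra. -/
def cubeHom : LatticeHom ((Fin 3 → Bool) × Bool) (D222ModTheta K) where
  toFun s := mk K (cubeElt n s)
  map_sup' s t := mk_cubeElt_eq fun hτ => by
    rw [map_sup, hτ.apply_cubeElt, hτ.apply_cubeElt, cubeValue_sup]
    cases cubeValue _ s <;> cases cubeValue _ t <;> simp
  map_inf' s t := mk_cubeElt_eq fun hτ => by
    rw [map_inf, hτ.apply_cubeElt, hτ.apply_cubeElt, cubeValue_inf]
    cases cubeValue _ s <;> cases cubeValue _ t <;> simp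

theorem cubeHom_injective : Function.Injective (cubeHom K n) := by
  have hvalue {s t : (Fin 3 → Bool) × Bool} (hst : cubeHom K n s = cubeHom K n t)
      {τ : PerfectType} (hτ : IsRealized K 0 τ) : cubeValue τ s = cubeValue τ t := by
    obtain ⟨X, _, _, _, ρ, hρ, -, h⟩ := hτ.of_zero n
    have := hρ.1
    have heq := Quotient.exact hst X ρ hρ
    rw [h.apply_cubeElt, h.apply_cubeElt] at heq
    cases hs : cubeValue τ s <;> cases ht : cubeValue τ t <;> simp_all
  exact fun s t hst => Prod.ext (funext fun i => hvalue hst (isRealized_arm_zero K i))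
    (hvalue hst (isRealized_center_zero K))

variable (K n) in
theorem image_cubes :
    mk K '' (lowerCube n ∪ upperCube (n + 1)) = Set.range (cubeHom K n) := by
  rw [← range_cubeElt, ← Set.range_comp]
  rfl

variable (K n) in
theorem image_lowerCube :
    mk K '' lowerCube n = Set.range ((cubeHom K n).comp (latticeHomSlice true)) := by
  rw [← range_lowerElt, ← Set.range_comp]
  rfl

variable (K n) in
theorem image_upperCube :
    mk K '' upperCube (n + 1) = Set.range ((cubeHom K n).comp (latticeHomSlice false)) := by
  rw [← range_upperElt, ← Set.range_comp]
  rfl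

theorem mk_upperElt_le_mk_lowerElt (s : Fin 3 → Bool) :
    mk K (upperElt n s) ≤ mk K (lowerElt n s) :=
  OrderHomClass.mono (cubeHom K n) (show (s, false) ≤ (s, true) from ⟨le_rfl, Bool.false_le _⟩)

end D222ModTheta

theorem mainTheorem7 (K : Type u) [Field K] (n : ℕ) :
    -- the two cubes are eight-element Boolean algebras modulo `θ`
    (IsBooleanSublattice (D222ModTheta.mk K '' D222.lowerCube n) ∧
      (D222ModTheta.mk K '' D222.lowerCube n).ncard = 8) ∧
    (IsBooleanSublattice (D222ModTheta.mk K '' D222.upperCube (n + 1)) ∧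
      (D222ModTheta.mk K '' D222.upperCube (n + 1)).ncard = 8) ∧
    -- their union is a sixteen-element Boolean algebra modulo `θ`
    (IsBooleanSublattice (D222ModTheta.mk K '' (D222.lowerCube n ∪ D222.upperCube (n + 1))) ∧
      (D222ModTheta.mk K '' (D222.lowerCube n ∪ D222.upperCube (n + 1))).ncard = 16) ∧
    -- the eight connecting inclusions modulo `θ`
    (∀ i j k : Fin 3, i ≠ j → i ≠ k → j ≠ k →
      D222ModTheta.mk K (D222.cGen i (n + 1)) ≤
        D222ModTheta.mk K (D222.aGen i n ⊓ D222.bGen j n ⊓ D222.bGen k n)) ∧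
    (∀ i j k : Fin 3, i ≠ j → i ≠ k → j ≠ k →
      D222ModTheta.mk K (D222.cGen i (n + 1) ⊓ D222.cGen j (n + 1)) ≤
        D222ModTheta.mk K (D222.aGen i n ⊓ D222.aGen j n ⊓ D222.bGen k n)) ∧
    D222ModTheta.mk K (D222.cGen 0 (n + 1) ⊓ D222.cGen 1 (n + 1) ⊓ D222.cGen 2 (n + 1)) ≤
      D222ModTheta.mk K (D222.aGen 0 n ⊓ D222.aGen 1 n ⊓ D222.aGen 2 n) ∧
    D222ModTheta.mk K (D222.cGen 0 (n + 1) ⊔ D222.cGen 1 (n + 1) ⊔ D222.cGen 2 (n + 1)) ≤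
      D222ModTheta.mk K (D222.bGen 0 n ⊓ D222.bGen 1 n ⊓ D222.bGen 2 n) := by
  have hslice (b : Bool) : Function.Injective ((D222ModTheta.cubeHom K n).comp
      (latticeHomSlice b)) := D222ModTheta.cubeHom_injective.comp (latticeHomSlice_injective b)
  have hle (s : Fin 3 → Bool) := D222ModTheta.mk_upperElt_le_mk_lowerElt (K := K) (n := n) s
  have h012 : D222.Distinct 0 1 2 := .add_one_add_two 0
  rw [D222ModTheta.image_lowerCube, D222ModTheta.image_upperCube, D222ModTheta.image_cubes]
  refine ⟨by simpa using isBooleanSublattice_range_and_ncard (hslice true),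
    by simpa using isBooleanSublattice_range_and_ncard (hslice false),
    by simpa using isBooleanSublattice_range_and_ncard D222ModTheta.cubeHom_injective,
    fun i j k hij hik hjk => ?_, fun i j k hij hik hjk => ?_, ?_, ?_⟩
  · have h : D222.Distinct i j k := ⟨hij, hjk, hik⟩
    simpa [D222.lowerElt, D222.upperElt, h.inf_univ_eq, h.forall_iff, hij.symm, hik.symm] using
      hle fun t => t ≠ i
  · have h : D222.Distinct i j k := ⟨hij, hjk, hik⟩
    simpa [D222.lowerElt, D222.upperElt, h.inf_univ_eq, h.forall_iff, hik, hjk] using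
      hle fun t => t = k
  · simpa [D222.lowerElt, D222.upperElt, h012.inf_univ_eq] using hle fun _ => false
  · simpa [D222.lowerElt, D222.upperElt, h012.inf_univ_eq] using hle fun _ => true
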